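/- **Setting.** Let $\mu$ be a probability measure on $[0,\infty)$ with $\mu([0,1])=1$ and $\mu\neq\delta_0$, let $\Omega=[0,\infty)^{\mathbb Z}$, $\mathbb P=\bigotimes_{k\in\mathbb Z}\mu$, and let $\mathbb E\{\omega_k\}=\int t\,d\mu(t)$. Let $l\ge 1$ and let $g$ be a real $C^2$ function with compact support in $(0,l)$, normalized by $\max\{\|g\|_{C[0,l]},\|g'\|_{C[0,l]},\|g''\|_{C[0,l]}\}=1$. For $\omega\in\Omega$ put $G(t,\omega)=\sum_{k\in\mathbb Z}\omega_k\,g(t-kl)$. For $\kappa>0$ and $N\in\mathbb N$ put $L=Nl$ and $$D_{\kappa,\omega}(N)=\{x\in\mathbb R^2:\ 0<x_1<L,\ \kappa G(x_1,\omega)<x_2<\kappa G(x_1,\omega)+\pi\}.$$ Let $\mathcal H_{\kappa,\omega}(N)$ be the negative Laplacian in $L^2(D_{\kappa,\omega}(N))$ with Dirichlet conditions on the upper and lower boundary ($x_2=\kappa G(x_1,\omega)+\pi$ and $x_2=\kappa G(x_1,\omega)$, $0<x_1<L$) and Neumann conditions on the rest of the boundary, and let $\lambda_{\kappa,\omega}(N)$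 be its lowest eigenvalue. Put $\widetilde g=g-\frac1l\int_0^l g(t)\,dt$ and $$c_2=\frac{3\|\widetilde g\|_{L^2(0,l)}^2}{2l^3},\qquad c_3=\frac{3\|\widetilde g\|_{L^2(0,l)}^2}{5000\,l^7},\qquad I_N=\left[\frac{2N^{\frac1\gamma-\frac14}}{\mathbb E\{\omega_k\}\sqrt{c_2}},\ c_3N^{-\frac{15}{2\gamma}}\right].$$ **Statement.** There is a constant $c_4>0$ depending only on $\mu$ such that for all $l$ and $g$ as above and every real $\gamma>34$ there is an $N_1\in\mathbb N$ such that for every $N\ge N_1$ the following hold. 1. (The defining properties of $N_1$ and $c_4$.) $I_N$ is non-empty, and for every $\kappa\in I_N$ $$\mathbb P\bigl(\lambda_{\kappa,\omega}(N)-1\le N^{-1/2}\bigr)\le N^{1-\frac1\gamma}e^{-c_4N^{1/\gamma}}.$$ 2. (The initial length scale estimate.) Let $\kappa\in I_N\cap[0,1]$ and $2\le\alpha,\beta\le L$, and set $$A=\{x\in\mathbb R^2:\ 0\le x_1\le\alpha,\ \kappa G(x_1,\omega)<x_2<\kappa G(x_1,\omega)+\pi\},$$ $$B=\{x\in\mathbb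 R^2:\ L-\beta\le x_1\le L,\ \kappa G(x_1,\omega)<x_2<\kappa G(x_1,\omega)+\pi\}.$$ Then, with probability at least $1-N^{1-\frac1\gamma}e^{-c_4N^{1/\gamma}}$, every $\lambda\in[1,\,1+1/(2\sqrt N)]$ lies in the resolvent set of $\mathcal H_{\kappa,\omega}(N)$ and satisfies $$\bigl\|\chi_A\,(\mathcal H_{\kappa,\omega}(N)-\lambda)^{-1}\chi_B\bigr\|\le 2\sqrt N\,\exp\left(-\frac{\operatorname{dist}(A,B)}{48\sqrt N}\right).$$ -/

import Mathlib

open MeasureTheory Set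
open scoped NNReal ENNReal

noncomputable section

namespace Waveguide

/-- The Euclidean plane `ℝ²`; the coordinates `x₁, x₂` of a point are `x 0, x 1`. -/
abbrev Plane : Type := EuclideanSpace ℝ (Fin 2)

/-! ### Geometry of the random waveguide -/

/-- The shape function `G(t, ω) = ∑_{k ∈ ℤ} ω_k g(t - k l)`.  For `g` supported in `(0, l)` at most
one term of the sum is nonzero. -/
def profile (l : ℝ) (g : ℝ → ℝ) (ω : ℤ → ℝ≥0) (t : ℝ) : ℝ :=
  ∑' k : ℤ, (ω k : ℝ) * g (t - k * l)

/-- The infinite waveguide `D_{κ,ω}`. -/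
def guide (l : ℝ) (g : ℝ → ℝ) (κ : ℝ) (ω : ℤ → ℝ≥0) : Set Plane :=
  {x | κ * profile l g ω (x 0) < x 1 ∧ x 1 < κ * profile l g ω (x 0) + Real.pi}

/-- The finite segment `D_{κ,ω}(N) = {x ∈ D_{κ,ω} : 0 < x₁ < N l}`. -/
def guideSegment (l : ℝ) (g : ℝ → ℝ) (κ : ℝ) (ω : ℤ → ℝ≥0) (N : ℕ) : Set Plane :=
  {x | 0 < x 0 ∧ x 0 < N * l} ∩ guide l g κ ω

/-- The part of the waveguide over the closed interval `a ≤ x₁ ≤ b`. -/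
def guidePiece (l : ℝ) (g : ℝ → ℝ) (κ : ℝ) (ω : ℤ → ℝ≥0) (a b : ℝ) : Set Plane :=
  {x | a ≤ x 0 ∧ x 0 ≤ b} ∩ guide l g κ ω

/-- The distance `inf {|a - b| : a ∈ A, b ∈ B}` of two sets in the plane. -/
def setDist (A B : Set Plane) : ℝ :=
  sInf {d | ∃ a ∈ A, ∃ b ∈ B, d = dist a b}

/-! ### The Laplacian with mixed boundary conditions -/

/-- The complex Hilbert space `L²(D)`. -/
abbrev L2 (D : Set Plane) : Type := Lp ℂ 2 (volume.restrict D)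

/-- The pairs `(φ|_D, (∇φ)|_D)`, where `φ ∈ C_c^∞(U)`. -/
def testGraph (D U : Set Plane) : Set (L2 D × (Fin 2 → L2 D)) :=
  {w | ∃ φ : Plane → ℂ, ContDiff ℝ (⊤ : ℕ∞) φ ∧ HasCompactSupport φ ∧ tsupport φ ⊆ U ∧
    w.1 =ᵐ[volume.restrict D] φ ∧
    ∀ i, w.2 i =ᵐ[volume.restrict D] fun x => fderiv ℝ φ x (EuclideanSpace.single i 1)}

/-- The pairs `(u, ∇u)` with `u` in the closure in `H¹(D)` of the restrictions to `D` of the functions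
in `C_c^∞(U)`; here `∇u` is the weak gradient.  For a finite segment `D` of the waveguide `U`, the
test functions vanish near the upper and the lower boundary and are arbitrary at the two vertical
sides; so these are the `H¹`-functions with zero trace on the upper and lower boundary of `D`, and
there is no condition on the vertical sides. -/
def formDomainGraph (D U : Set Plane) : Submodule ℂ (L2 D × (Fin 2 → L2 D)) :=
  (Submodule.span ℂ (testGraph D U)).topologicalClosure

/-- The pairs `(u, f)` such that `u` is in the form domain and
`∫_D ∇u · conj ∇v = ∫_D f conj v` for all `v` in the form domain. -/
def laplacianGraph (D U : Set Plane) : Submodule ℂ (L2 D × L2 D) where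
  carrier := {w | ∃ p, (w.1, p) ∈ formDomainGraph D U ∧
    ∀ z ∈ formDomainGraph D U, ∑ i, inner ℂ (z.2 i) (p i) = inner ℂ z.1 w.2}
  zero_mem' := ⟨0, (formDomainGraph D U).zero_mem, fun z _ => by simp⟩
  add_mem' := by
    rintro ⟨u, f⟩ ⟨u', f'⟩ ⟨p, hp, h⟩ ⟨p', hp', h'⟩
    refine ⟨p + p', (formDomainGraph D U).add_mem hp hp', fun z hz => ?_⟩
    simp only [Pi.add_apply, inner_add_right, Finset.sum_add_distrib, Prod.mk_add_mk]
    rw [h z hz, h' z hz]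
  smul_mem' := by
    rintro c ⟨u, f⟩ ⟨p, hp, h⟩
    refine ⟨c • p, (formDomainGraph D U).smul_mem c hp, fun z hz => ?_⟩
    simp only [Pi.smul_apply, inner_smul_right, Prod.smul_mk]
    rw [← Finset.mul_sum, h z hz]

/-- The negative Laplacian of the closed form `u ↦ ∫_D |∇u|²` on the above form domain, as an unbounded
operator in `L²(D)`: `u` is in its domain and is mapped to `f` iff `(u, f)` is in `laplacianGraph`
(see `mixedLaplacian_graph`). -/
def mixedLaplacian (D U : Set Plane) : L2 D →ₗ.[ℂ] L2 D :=
  (laplacianGraph D U).toLinearPMap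

theorem laplacianGraph_functional {D U : Set Plane} (hD : IsOpen D) (hDU : D ⊆ U)
    (x : L2 D × L2 D) (hx : x ∈ laplacianGraph D U) (hx0 : x.1 = 0) : x.2 = 0 := by
  obtain ⟨u, f⟩ := x
  simp only at hx0
  subst hx0
  obtain ⟨p, hp, h⟩ := hx
  simp only at hp h ⊢
  have hp0 : p = 0 := by
    have h1 := h (0, p) hp
    simp only [inner_zero_left, inner_self_eq_norm_sq_to_K] at h1
    have h2 : ∑ i, ‖p i‖ ^ 2 = 0 := by
      apply Complex.ofReal_injective
      push_cast
      exact h1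
    rw [Finset.sum_eq_zero_iff_of_nonneg (fun i _ => by positivity)] at h2
    ext1 i
    simpa using h2 i (Finset.mem_univ i)
  subst hp0
  have hf : LocallyIntegrableOn (f : Plane → ℂ) D volume := by
    have h1 : LocallyIntegrable (f : Plane → ℂ) (volume.restrict D) :=
      (Lp.memLp f).locallyIntegrable (by norm_num)
    exact locallyIntegrableOn_of_locallyIntegrable_restrict h1
  have key := hD.ae_eq_zero_of_integral_contDiff_smul_eq_zero hf (fun φ hφ hφc hφD => by
    have hφC : ContDiff ℝ (⊤ : ℕ∞) (fun x => (φ x : ℂ)) := Complex.ofRealCLM.contDiff.comp hφ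
    have hφCc : HasCompactSupport (fun x => (φ x : ℂ)) := hφc.comp_left Complex.ofReal_zero
    have hsupp : tsupport (fun x => (φ x : ℂ)) ⊆ U :=
      (closure_mono (fun x hx => by
        simp only [Function.mem_support, ne_eq, Complex.ofReal_eq_zero] at hx ⊢
        exact hx)).trans (hφD.trans hDU)
    have hm : MemLp (fun x => (φ x : ℂ)) 2 (volume.restrict D) :=
      (hφC.continuous.memLp_of_hasCompactSupport hφCc)
    have hq : ∀ i : Fin 2, MemLp (fun x => fderiv ℝ (fun x => (φ x : ℂ)) x
        (EuclideanSpace.single i (1 : ℝ))) 2 (volume.restrict D) := fun i =>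
      ((hφC.continuous_fderiv (by simp)).clm_apply continuous_const).memLp_of_hasCompactSupport
        (hφCc.fderiv_apply ℝ _)
    have hmem : (hm.toLp _, fun i => (hq i).toLp _) ∈ formDomainGraph D U :=
      Submodule.le_topologicalClosure _ (Submodule.subset_span
        ⟨_, hφC, hφCc, hsupp, hm.coeFn_toLp, fun i => (hq i).coeFn_toLp⟩)
    have h1 := h _ hmem
    simp only [Pi.zero_apply, inner_zero_right, Finset.sum_const_zero] at h1
    rw [L2.inner_def] at h1
    have h2 : ∫ x in D, φ x • f x = 0 := by
      rw [h1]
      refine integral_congr_ae ?_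
      filter_upwards [hm.coeFn_toLp] with x hx
      simp [hx, mul_comm]
    rw [← h2, setIntegral_eq_integral_of_forall_compl_eq_zero]
    intro x hx
    rw [image_eq_zero_of_notMem_tsupport (fun hx' => hx (hφD hx')), zero_smul])
  rw [Lp.eq_zero_iff_ae_eq_zero]
  exact (ae_restrict_iff' hD.measurableSet).2 key

theorem mixedLaplacian_graph {D U : Set Plane} (hD : IsOpen D) (hDU : D ⊆ U) :
    (mixedLaplacian D U).graph = laplacianGraph D U :=
  Submodule.toLinearPMap_graph_eq _ (laplacianGraph_functional hD hDU)

/-- The operator `ℋ_{κ,ω}(N)`: the negative Laplacian on `D_{κ,ω}(N)` with Dirichlet conditions on the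
upper and lower boundary and Neumann conditions on the two vertical sides. -/
def hamiltonian (l : ℝ) (g : ℝ → ℝ) (κ : ℝ) (ω : ℤ → ℝ≥0) (N : ℕ) :
    L2 (guideSegment l g κ ω N) →ₗ.[ℂ] L2 (guideSegment l g κ ω N) :=
  mixedLaplacian (guideSegment l g κ ω N) (guide l g κ ω)

/-- `E` is an eigenvalue of the unbounded operator `H`. -/
def IsEigenvalue {X : Type*} [AddCommGroup X] [Module ℂ X] (H : X →ₗ.[ℂ] X) (E : ℝ) : Prop :=
  ∃ u : H.domain, (u : X) ≠ 0 ∧ H u = (E : ℂ) • (u : X)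

/-- `z` is in the resolvent set of the unbounded operator `H`, and the bounded operator `R` is
`(H - z)⁻¹`. -/
def IsResolvent {X : Type*} [NormedAddCommGroup X] [NormedSpace ℂ X] (H : X →ₗ.[ℂ] X) (z : ℂ)
    (R : X →L[ℂ] X) : Prop :=
  (∀ f : X, ∃ h : R f ∈ H.domain, H ⟨R f, h⟩ - z • R f = f) ∧
    ∀ u : H.domain, R (H u - z • (u : X)) = u

open Classical in
/-- Multiplication by the indicator function of the measurable set `A`, as a bounded operator in
`L²(D)`. -/
def chi (D A : Set Plane) : L2 D →L[ℂ] L2 D :=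
  if hA : MeasurableSet A then
    LinearMap.mkContinuous
      { toFun := fun f => ((Lp.memLp f).indicator hA).toLp (A.indicator f)
        map_add' := fun f f' => by
          rw [← MemLp.toLp_add]
          refine MemLp.toLp_congr _ _ ?_
          filter_upwards [Lp.coeFn_add f f'] with x hx
          rw [Pi.add_apply] at hx ⊢
          by_cases h : x ∈ A
          · simp only [indicator_of_mem h]
            exact hx
          · simp [h]
        map_smul' := fun c f => by
          rw [RingHom.id_apply, ← MemLp.toLp_const_smul]
          refine MemLp.toLp_congr _ _ ?_
          filter_upwards [Lp.coeFn_smul c f] with x hx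
          rw [Pi.smul_apply] at hx ⊢
          by_cases h : x ∈ A
          · simp only [indicator_of_mem h]
            exact hx
          · simp [h] }
      1 (fun f => by
        rw [one_mul]
        refine Lp.norm_le_norm_of_ae_le ?_
        filter_upwards [((Lp.memLp f).indicator hA).coeFn_toLp] with x hx
        simp only [LinearMap.coe_mk, AddHom.coe_mk]
        rw [hx]
        exact norm_indicator_le_norm_self _ _)
  else 0

theorem chi_apply {D A : Set Plane} (hA : MeasurableSet A) (f : L2 D) :
    chi D A f =ᵐ[volume.restrict D] A.indicator f := by
  rw [chi, dif_pos hA]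
  exact ((Lp.memLp f).indicator hA).coeFn_toLp

/-! ### Regularity of the waveguide -/

theorem continuous_profile {l : ℝ} {g : ℝ → ℝ} (hl : 0 < l) (hg : Continuous g)
    (hs : Function.support g ⊆ Ioo 0 l) (ω : ℤ → ℝ≥0) : Continuous (profile l g ω) := by
  have hsupp : ∀ (k : ℤ) (t : ℝ), (ω k : ℝ) * g (t - k * l) ≠ 0 → k = ⌊t / l⌋ := by
    intro k t h
    have h1 := hs (Function.mem_support.2 (right_ne_zero_of_mul h))
    rw [eq_comm, Int.floor_eq_iff, le_div_iff₀ hl, div_lt_iff₀ hl]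
    constructor <;> nlinarith [h1.1, h1.2]
  have hlf : LocallyFinite fun k : ℤ => Function.support fun t => (ω k : ℝ) * g (t - k * l) := by
    intro t
    refine ⟨Ioo (t - 1) (t + 1), Ioo_mem_nhds (by linarith) (by linarith),
      (Set.finite_Icc ⌊(t - 1) / l⌋ ⌊(t + 1) / l⌋).subset ?_⟩
    rintro k ⟨s, hs1, hs2⟩
    rw [hsupp k s hs1]
    exact ⟨Int.floor_mono (by gcongr; exact hs2.1.le), Int.floor_mono (by gcongr; exact hs2.2.le)⟩
  have heq : profile l g ω = fun t => ∑ᶠ k : ℤ, (ω k : ℝ) * g (t - k * l) := by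
    ext t
    refine tsum_eq_finsum ((Set.finite_singleton ⌊t / l⌋).subset fun k hk => hsupp k t hk)
  rw [heq]
  exact continuous_finsum (fun k => by fun_prop) hlf

theorem isOpen_guide {l : ℝ} {g : ℝ → ℝ} (hl : 0 < l) (hg : Continuous g)
    (hs : Function.support g ⊆ Ioo 0 l) (κ : ℝ) (ω : ℤ → ℝ≥0) : IsOpen (guide l g κ ω) := by
  have hc := continuous_profile hl hg hs ω
  have h1 : IsOpen {x : Plane | κ * profile l g ω (x 0) < x 1} :=
    isOpen_lt (by fun_prop) (by fun_prop)
  have h2 : IsOpen {x : Plane | x 1 < κ * profile l g ω (x 0) + Real.pi} :=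
    isOpen_lt (by fun_prop) (by fun_prop)
  exact h1.inter h2

theorem isOpen_guideSegment {l : ℝ} {g : ℝ → ℝ} (hl : 0 < l) (hg : Continuous g)
    (hs : Function.support g ⊆ Ioo 0 l) (κ : ℝ) (ω : ℤ → ℝ≥0) (N : ℕ) :
    IsOpen (guideSegment l g κ ω N) := by
  have h1 : IsOpen {x : Plane | 0 < x 0} := isOpen_lt (by fun_prop) (by fun_prop)
  have h2 : IsOpen {x : Plane | x 0 < N * l} := isOpen_lt (by fun_prop) (by fun_prop)
  exact (h1.inter h2).inter (isOpen_guide hl hg hs κ ω)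

theorem measurableSet_guidePiece {l : ℝ} {g : ℝ → ℝ} (hl : 0 < l) (hg : Continuous g)
    (hs : Function.support g ⊆ Ioo 0 l) (κ : ℝ) (ω : ℤ → ℝ≥0) (a b : ℝ) :
    MeasurableSet (guidePiece l g κ ω a b) := by
  have h1 : IsClosed {x : Plane | a ≤ x 0} := isClosed_le (by fun_prop) (by fun_prop)
  have h2 : IsClosed {x : Plane | x 0 ≤ b} := isClosed_le (by fun_prop) (by fun_prop)
  exact (h1.inter h2).measurableSet.inter (isOpen_guide hl hg hs κ ω).measurableSet

/-! ### Constants and the coupling interval -/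

/-- The norm of `f` in `C[0, l]`. -/
def supNorm (l : ℝ) (f : ℝ → ℝ) : ℝ := sSup ((fun t => |f t|) '' Icc 0 l)

/-- A single bump function: `g ∈ C²` with compact support in `(0, l)`, normalized by
`max {‖g‖, ‖g'‖, ‖g''‖} = 1` in `C[0, l]`. -/
structure IsBump (l : ℝ) (g : ℝ → ℝ) : Prop where
  contDiff : ContDiff ℝ 2 g
  tsupport_subset : tsupport g ⊆ Ioo 0 l
  normalized : max (supNorm l g) (max (supNorm l (deriv g)) (supNorm l (deriv (deriv g)))) = 1

/-- `‖g̃‖²` in `L²(0, l)`, where `g̃ = g - l⁻¹ ∫₀ˡ g`. -/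
def gTildeNormSq (l : ℝ) (g : ℝ → ℝ) : ℝ :=
  ∫ t in (0 : ℝ)..l, (g t - (1 / l) * ∫ s in (0 : ℝ)..l, g s) ^ 2

def c₂ (l : ℝ) (g : ℝ → ℝ) : ℝ := 3 * gTildeNormSq l g / (2 * l ^ 3)

def c₃ (l : ℝ) (g : ℝ → ℝ) : ℝ := 3 * gTildeNormSq l g / (5000 * l ^ 7)

/-- The expectation of a random variable with distribution `μ`. -/
def mean (μ : Measure ℝ≥0) : ℝ := ∫ t, (t : ℝ) ∂μ

/-- The interval `I_N` of coupling constants. -/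
def couplingInterval (μ : Measure ℝ≥0) (l : ℝ) (g : ℝ → ℝ) (γ : ℝ) (N : ℕ) : Set ℝ :=
  Icc (2 * (N : ℝ) ^ (1 / γ - 1 / 4) / (mean μ * √(c₂ l g)))
    (c₃ l g * (N : ℝ) ^ (-(15 / (2 * γ))))

/-- The product measure `⨂_{k ∈ ℤ} μ`, the law of an i.i.d. family `(ω_k)_{k ∈ ℤ}` with common
distribution `μ`. -/
def law (μ : Measure ℝ≥0) : Measure (ℤ → ℝ≥0) := Measure.infinitePi fun _ : ℤ => μ

/-- The bound `N^{1 - 1/γ} e^{-c N^{1/γ}}` on the probability of the exceptional event. -/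
def tail (c γ : ℝ) (N : ℕ) : ℝ :=
  (N : ℝ) ^ (1 - 1 / γ) * Real.exp (-c * (N : ℝ) ^ (1 / γ))

end Waveguide

end

/-!
Straightening the guide by `(x₁, x₂) ↦ (x₁, x₂ - κ G(x₁))` turns `∫ |∇u|²` on `D_{κ,ω}(N)` into
`∫∫ (v₁ - P v₂)² + v₂²` on a rectangle of height `π`, where `P = κ G'` is the slope of the guide,
`v₁`, `v₂` are the partial derivatives of `v`, and `v` vanishes at the top and the bottom. The
statement rests on a lower bound `1 + δ` with `δ = 2 / √N` for this form, valid on a good event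
(`form_bound_guide`).

Write `X` for the excess of the form over `‖v‖²`. Fibrewise, the spectral gap of the Dirichlet
interval `(0, π)` bounds everything but the component `f = ∫ v sin` of `v` by `X`, in particular
`h = ∫ v cos` (`fibre_estimates`). Testing `v₁ - P v₂` against `sin` and `cos` shows that `f' + P
h` and `h' - P f` are bounded by `X` as well. Hence `f` is nearly constant and `∫ P² f` is small,
so that `f` itself is bounded by `X` unless `∫ P²` is small (`integral_sq_le_of_system`,
`integral_strip_le`). This is applied on blocks of about `N^{1/γ}` cells, where `P` vanishes at
the ends. On the good event the mean of the `ω_k` over every block is at least half of its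
expectation, which bounds `∫ P²` from below by a multiple of `κ²` times the block length; for `κ ∈
I_N` and `N` large the constants work out (`eventually_coupling`). By Hoeffding's inequality the
good event fails with probability at most the number of blocks, `N^{1 - 1/γ}`, times `e^{-c₄
N^{1/γ}}` with `c₄ = 𝔼{ω_k}² / 2` (`law_goodSet_compl_le`).

The form bound excludes eigenvalues below `1 + δ` and yields the resolvent by Riesz representation
on the form domain (`exists_isResolvent`). Multiplication by the weight `e^{a (L - β - x₁)}`
preserves the form domain and lowers the form bound by at most `a²`, which gives the exponential
decay (`weighted_estimate`, `norm_chi_resolvent_chi_le`); the distance of the two end pieces is at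
most their separation along the axis, as both contain points at height `π / 2`.
-/

noncomputable section

namespace Waveguide

/-! ### One-dimensional inequalities -/

theorem sq_integral_mul_le {a b : ℝ} (hab : a ≤ b) {f g : ℝ → ℝ} (hf : Continuous f)
    (hg : Continuous g) :
    (∫ x in a..b, f x * g x) ^ 2 ≤ (∫ x in a..b, f x ^ 2) * ∫ x in a..b, g x ^ 2 := by
  have key : ∀ t : ℝ, 0 ≤ (∫ x in a..b, g x ^ 2) * (t * t) +
      (-2 * ∫ x in a..b, f x * g x) * t + ∫ x in a..b, f x ^ 2 := by
    intro t
    have h0 : 0 ≤ ∫ x in a..b, (f x - t * g x) ^ 2 :=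
      intervalIntegral.integral_nonneg hab fun x _ => sq_nonneg _
    have h1 : ∫ x in a..b, (f x - t * g x) ^ 2 =
        ∫ x in a..b, (f x ^ 2 - (2 * t) * (f x * g x)) + (t * t) * g x ^ 2 := by
      congr 1; ext x; ring
    rw [h1, intervalIntegral.integral_add, intervalIntegral.integral_sub,
      intervalIntegral.integral_const_mul, intervalIntegral.integral_const_mul] at h0
    · linarith
    all_goals exact Continuous.intervalIntegrable (by fun_prop) _ _
  have := discrim_le_zero key
  rw [discrim] at this
  nlinarith

/-- On an interval `[a, b] ⊆ (0, π)` at whose ends `φ` vanishes, `∫ (φ'² - φ²)` equals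
`∫ (φ' - φ cot)² = ∫ (sin · (φ / sin)')²`; this bounds the increments of `φ / sin`.  The parameter `s`
stands in for the Cauchy-Schwarz inequality. -/
theorem increment_div_sin_le {φ φ' : ℝ → ℝ} (hφ : ∀ y, HasDerivAt φ (φ' y) y) (hc : Continuous φ')
    {a b u w : ℝ} (ha : 0 < a) (hau : a ≤ u) (huw : u ≤ w) (hwb : w ≤ b) (hb : b < Real.pi)
    (hφa : φ a = 0) (hφb : φ b = 0) (s : ℝ) :
    2 * s * (φ w / Real.sin w - φ u / Real.sin u) ≤ (∫ y in a..b, (φ' y ^ 2 - φ y ^ 2)) +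
      s ^ 2 * (Real.cos u / Real.sin u - Real.cos w / Real.sin w) := by
  have hφc : Continuous φ := continuous_iff_continuousAt.2 fun y => (hφ y).continuousAt
  have hsin : ∀ y ∈ Icc a b, Real.sin y ≠ 0 := fun y hy =>
    (Real.sin_pos_of_pos_of_lt_pi (by linarith [hy.1]) (by linarith [hy.2])).ne'
  have hab : a ≤ b := by linarith
  set q : ℝ → ℝ := fun y => φ' y - φ y * (Real.cos y / Real.sin y) with hq
  have hqc : ContinuousOn q (Icc a b) :=
    hc.continuousOn.sub (hφc.continuousOn.mul
      (Real.continuous_cos.continuousOn.div Real.continuous_sin.continuousOn hsin))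
  have hqc2 : ContinuousOn (fun y => q y ^ 2) (Icc a b) := hqc.pow 2
  have hcot : ∀ y ∈ Icc a b, HasDerivAt (fun y => Real.cos y / Real.sin y)
      (-(1 / Real.sin y ^ 2)) y := fun y hy => by
    refine ((Real.hasDerivAt_cos y).div (Real.hasDerivAt_sin y) (hsin y hy)).congr_deriv ?_
    rw [← neg_div]
    congr 1
    linear_combination -(Real.sin_sq_add_cos_sq y)
  -- the ground state representation of the energy
  have hK : ∫ y in a..b, (φ' y ^ 2 - φ y ^ 2) = ∫ y in a..b, q y ^ 2 := by
    have hd : ∀ y ∈ uIcc a b, HasDerivAt (fun y => φ y ^ 2 * (Real.cos y / Real.sin y))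
        (φ' y ^ 2 - φ y ^ 2 - q y ^ 2) y := fun y hy => by
      rw [uIcc_of_le hab] at hy
      refine (((hφ y).pow 2).mul (hcot y hy)).congr_deriv ?_
      have h1 := hsin y hy
      have h2 : Real.cos y ^ 2 = 1 - Real.sin y ^ 2 := by linarith [Real.sin_sq_add_cos_sq y]
      simp only [hq, Pi.pow_apply]
      field_simp
      linear_combination (φ y ^ 2) * h2
    have hint := intervalIntegral.integral_eq_sub_of_hasDerivAt hd (by
      refine ContinuousOn.intervalIntegrable ?_
      rw [uIcc_of_le hab]
      exact ((hc.pow 2).sub (hφc.pow 2)).continuousOn.sub hqc2)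
    rw [intervalIntegral.integral_sub, hφa, hφb] at hint
    · simpa [sub_eq_zero] using hint
    · exact Continuous.intervalIntegrable (by fun_prop) _ _
    · refine ContinuousOn.intervalIntegrable ?_
      rwa [uIcc_of_le hab]
  rw [hK]
  have hsub : Icc u w ⊆ Icc a b := Icc_subset_Icc hau hwb
  have hqi : ∀ c d, c ∈ Icc a b → d ∈ Icc a b →
      IntervalIntegrable (fun y => q y ^ 2) volume c d := fun c d h1 h2 =>
    (hqc2.mono (uIcc_subset_Icc h1 h2)).intervalIntegrable
  have hle : ∫ y in u..w, q y ^ 2 ≤ ∫ y in a..b, q y ^ 2 :=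
    intervalIntegral.integral_mono_interval hau huw hwb
      (Filter.Eventually.of_forall fun y => sq_nonneg (q y))
      (hqi a b ⟨le_rfl, hab⟩ ⟨hab, le_rfl⟩)
  have hd : ∀ y ∈ uIcc u w, HasDerivAt
      (fun y => 2 * s * (φ y / Real.sin y) + s ^ 2 * (Real.cos y / Real.sin y))
        (q y ^ 2 - (q y - s / Real.sin y) ^ 2) y := fun y hy => by
    rw [uIcc_of_le huw] at hy
    have h1 := hsin y (hsub hy)
    refine ((((hφ y).div (Real.hasDerivAt_sin y) h1).const_mul (2 * s)).add
      ((hcot y (hsub hy)).const_mul (s ^ 2))).congr_deriv ?_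
    simp only [hq]
    field_simp
    ring
  have hs1 : ContinuousOn (fun y => (q y - s / Real.sin y) ^ 2) (Icc u w) :=
    ((hqc.mono hsub).sub (continuousOn_const.div Real.continuous_sin.continuousOn
      fun y hy => hsin y (hsub hy))).pow 2
  have hi1 : IntervalIntegrable (fun y => (q y - s / Real.sin y) ^ 2) volume u w := by
    refine ContinuousOn.intervalIntegrable ?_
    rwa [uIcc_of_le huw]
  have hi2 := hqi u w (hsub ⟨le_rfl, huw⟩) (hsub ⟨huw, le_rfl⟩)
  have hint := intervalIntegral.integral_eq_sub_of_hasDerivAt hd (hi2.sub hi1)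
  rw [intervalIntegral.integral_sub hi2 hi1] at hint
  have h0 : 0 ≤ ∫ y in u..w, (q y - s / Real.sin y) ^ 2 :=
    intervalIntegral.integral_nonneg huw fun y _ => sq_nonneg _
  nlinarith

/-- The energy above the ground state energy `1` of the Dirichlet interval `(0, π)` controls the
distance to a multiple of the ground state, uniformly on the interval. -/
theorem sq_sub_sin_le {φ φ' : ℝ → ℝ} (hφ : ∀ y, HasDerivAt φ (φ' y) y) (hc : Continuous φ')
    {ε : ℝ} (hε : 0 < ε) (hεπ : ε < Real.pi / 2)
    (hz : ∀ y, y < ε ∨ Real.pi - ε < y → φ y = 0 ∧ φ' y = 0) {x : ℝ} (hx : x ∈ Icc 0 Real.pi) :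
    (φ x - φ (Real.pi / 2) * Real.sin x) ^ 2 ≤ ∫ y in (0 : ℝ)..Real.pi, (φ' y ^ 2 - φ y ^ 2) := by
  have hφc : Continuous φ := continuous_iff_continuousAt.2 fun y => (hφ y).continuousAt
  have hpi := Real.pi_pos
  -- the increments of `φ / sin` between `x` and `π / 2`, for `x` in the open interval
  have main : ∀ x ∈ Ioo 0 Real.pi,
      (φ x - φ (Real.pi / 2) * Real.sin x) ^ 2 ≤
        ∫ y in (0 : ℝ)..Real.pi, (φ' y ^ 2 - φ y ^ 2) := by
    intro x hx
    set a := min (ε / 2) (min x (Real.pi - x)) with ha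
    have ha0 : 0 < a := by
      simp only [ha, lt_min_iff]; exact ⟨by linarith, hx.1, by linarith [hx.2]⟩
    have haε : a < ε := (min_le_left _ _).trans_lt (by linarith)
    have hax : a ≤ x := (min_le_right _ _).trans (min_le_left _ _)
    have hax' : a ≤ Real.pi - x := (min_le_right _ _).trans (min_le_right _ _)
    have hint : ∀ c d, IntervalIntegrable (fun y => φ' y ^ 2 - φ y ^ 2) volume c d :=
      fun c d => Continuous.intervalIntegrable (by fun_prop) _ _
    have hzero : ∀ c d, (∀ y ∈ uIcc c d, y < ε ∨ Real.pi - ε < y) →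
        ∫ y in c..d, (φ' y ^ 2 - φ y ^ 2) = 0 := fun c d h => by
      rw [intervalIntegral.integral_congr (g := fun _ => 0) fun y hy => by
        simp [(hz y (h y hy)).1, (hz y (h y hy)).2]]
      simp
    have hK : ∫ y in (0 : ℝ)..Real.pi, (φ' y ^ 2 - φ y ^ 2) =
        ∫ y in a..(Real.pi - a), (φ' y ^ 2 - φ y ^ 2) := by
      rw [← intervalIntegral.integral_add_adjacent_intervals (hint 0 a) (hint a _),
        ← intervalIntegral.integral_add_adjacent_intervals (hint a (Real.pi - a)) (hint _ _),
        hzero 0 a, hzero (Real.pi - a) Real.pi]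
      · ring
      · intro y hy
        rw [uIcc_of_le (by linarith)] at hy
        exact Or.inr (by linarith [hy.1])
      · intro y hy
        rw [uIcc_of_le (by linarith)] at hy
        exact Or.inl (by linarith [hy.2])
    rw [hK]
    set K := ∫ y in a..(Real.pi - a), (φ' y ^ 2 - φ y ^ 2)
    have hsx : 0 < Real.sin x := Real.sin_pos_of_pos_of_lt_pi hx.1 hx.2
    have hφa := (hz a (Or.inl haε)).1
    have hφb := (hz (Real.pi - a) (Or.inr (by linarith))).1
    set Δ := φ x / Real.sin x - φ (Real.pi / 2) with hΔ
    have hρ : φ x - φ (Real.pi / 2) * Real.sin x = Δ * Real.sin x := by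
      rw [hΔ]; field_simp
    have hcube : Real.sin x ^ 3 * |Real.cos x| ≤ Real.sin x ^ 2 := by
      have h1 : Real.sin x * |Real.cos x| ≤ 1 := by
        nlinarith [Real.sin_le_one x, Real.abs_cos_le_one x, abs_nonneg (Real.cos x)]
      nlinarith [sq_nonneg (Real.sin x)]
    have hfin : 2 * Δ ^ 2 * Real.sin x ^ 2 ≤ K + Δ ^ 2 * (Real.sin x ^ 3 * |Real.cos x|) := by
      rcases le_total x (Real.pi / 2) with h | h
      · have := increment_div_sin_le hφ hc ha0 hax h (by linarith) (by linarith) hφa hφb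
          (-(Δ * Real.sin x ^ 2))
        rw [Real.sin_pi_div_two, Real.cos_pi_div_two] at this
        have hcp : 0 ≤ Real.cos x := Real.cos_nonneg_of_neg_pi_div_two_le_of_le (by linarith) h
        rw [abs_of_nonneg hcp]
        have e1 : (-(Δ * Real.sin x ^ 2)) ^ 2 * (Real.cos x / Real.sin x - 0 / 1) =
            Δ ^ 2 * (Real.sin x ^ 3 * Real.cos x) := by field_simp; ring
        rw [e1] at this
        have e2 : 2 * (-(Δ * Real.sin x ^ 2)) * (φ (Real.pi / 2) / 1 - φ x / Real.sin x) =
            2 * Δ ^ 2 * Real.sin x ^ 2 := by rw [hΔ]; ring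
        rwa [e2] at this
      · have := increment_div_sin_le hφ hc ha0 (by linarith) h (by linarith) (by linarith) hφa hφb
          (Δ * Real.sin x ^ 2)
        rw [Real.sin_pi_div_two, Real.cos_pi_div_two] at this
        have hcp : Real.cos x ≤ 0 :=
          Real.cos_nonpos_of_pi_div_two_le_of_le h (by linarith [hx.2])
        rw [abs_of_nonpos hcp]
        have e1 : (Δ * Real.sin x ^ 2) ^ 2 * (0 / 1 - Real.cos x / Real.sin x) =
            Δ ^ 2 * (Real.sin x ^ 3 * -Real.cos x) := by field_simp; ring
        rw [e1] at this
        have e2 : 2 * (Δ * Real.sin x ^ 2) * (φ x / Real.sin x - φ (Real.pi / 2) / 1) =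
            2 * Δ ^ 2 * Real.sin x ^ 2 := by rw [hΔ]; ring
        rwa [e2] at this
    rw [hρ, mul_pow]
    nlinarith [mul_le_mul_of_nonneg_left hcube (sq_nonneg Δ)]
  rcases eq_or_lt_of_le hx.1 with h | h
  · have h0 : φ x = 0 := (hz x (Or.inl (by linarith))).1
    rw [h0, ← h, Real.sin_zero, mul_zero, sub_zero, zero_pow two_ne_zero]
    exact (sq_nonneg _).trans (main (Real.pi / 2) ⟨by linarith, by linarith⟩)
  rcases eq_or_lt_of_le hx.2 with h' | h'
  · have h0 : φ x = 0 := (hz x (Or.inr (by linarith))).1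
    rw [h0, h', Real.sin_pi, mul_zero, sub_zero, zero_pow two_ne_zero]
    exact (sq_nonneg _).trans (main (Real.pi / 2) ⟨by linarith, by linarith⟩)
  exact main x ⟨h, h'⟩

/-- Quantitative form of the spectral gap of the Dirichlet interval `(0, π)`: the energy `K` above the
ground state energy controls the component of `φ` along `cos`, and the whole of `φ` up to its
component along the ground state `sin`. -/
theorem fibre_estimates {φ φ' : ℝ → ℝ} (hφ : ∀ y, HasDerivAt φ (φ' y) y) (hc : Continuous φ')
    {ε : ℝ} (hε : 0 < ε) (hεπ : ε < Real.pi / 2)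
    (hz : ∀ y, y < ε ∨ Real.pi - ε < y → φ y = 0 ∧ φ' y = 0) {K : ℝ}
    (hK : K = ∫ y in (0 : ℝ)..Real.pi, (φ' y ^ 2 - φ y ^ 2)) :
    0 ≤ K ∧ (∫ y in (0 : ℝ)..Real.pi, φ y * Real.cos y) ^ 2 ≤ 10 * K ∧
      ∫ y in (0 : ℝ)..Real.pi, φ y ^ 2 ≤
        14 * (∫ y in (0 : ℝ)..Real.pi, φ y * Real.sin y) ^ 2 + 60 * K := by
  have hφc : Continuous φ := continuous_iff_continuousAt.2 fun y => (hφ y).continuousAt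
  have hpi := Real.pi_pos
  have hpi3 := Real.pi_gt_three
  have hpi4 : Real.pi < 3.15 := Real.pi_lt_d2
  have hpt : ∀ x ∈ Icc 0 Real.pi, (φ x - φ (Real.pi / 2) * Real.sin x) ^ 2 ≤ K := fun x hx =>
    hK ▸ sq_sub_sin_le hφ hc hε hεπ hz hx
  have hK0 : 0 ≤ K := (sq_nonneg _).trans (hpt 0 ⟨le_rfl, hpi.le⟩)
  set z := φ (Real.pi / 2)
  set ρ : ℝ → ℝ := fun y => φ y - z * Real.sin y with hρ
  have hρc : Continuous ρ := by fun_prop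
  have hρb : ∀ x ∈ Icc 0 Real.pi, |ρ x| ≤ √K := fun x hx => Real.abs_le_sqrt (hpt x hx)
  have hbound : ∀ t : ℝ → ℝ, (∀ y, |t y| ≤ 1) →
      (∫ y in (0 : ℝ)..Real.pi, ρ y * t y) ^ 2 ≤ Real.pi ^ 2 * K := by
    intro t ht
    have h1 : ‖∫ y in (0 : ℝ)..Real.pi, ρ y * t y‖ ≤ √K * |Real.pi - 0| := by
      refine intervalIntegral.norm_integral_le_of_norm_le_const fun y hy => ?_
      rw [uIoc_of_le hpi.le] at hy
      rw [Real.norm_eq_abs, abs_mul]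
      calc |ρ y| * |t y| ≤ √K * 1 := by
            gcongr
            · exact hρb y ⟨hy.1.le, hy.2⟩
            · exact ht y
        _ = √K := mul_one _
    rw [sub_zero, abs_of_pos hpi, Real.norm_eq_abs] at h1
    calc (∫ y in (0 : ℝ)..Real.pi, ρ y * t y) ^ 2 = |∫ y in (0 : ℝ)..Real.pi, ρ y * t y| ^ 2 :=
          (sq_abs _).symm
      _ ≤ (√K * Real.pi) ^ 2 := by gcongr
      _ = Real.pi ^ 2 * K := by rw [mul_pow, Real.sq_sqrt hK0]; ring
  have hcos := hbound Real.cos Real.abs_cos_le_one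
  have hsin := hbound Real.sin Real.abs_sin_le_one
  have hsplit : ∀ t : ℝ → ℝ, Continuous t → ∫ y in (0 : ℝ)..Real.pi, ρ y * t y =
      (∫ y in (0 : ℝ)..Real.pi, φ y * t y) - z * ∫ y in (0 : ℝ)..Real.pi, Real.sin y * t y := by
    intro t ht
    rw [← intervalIntegral.integral_const_mul, ← intervalIntegral.integral_sub]
    · congr 1; ext y; simp only [hρ]; ring
    · exact Continuous.intervalIntegrable (by fun_prop) _ _
    · exact Continuous.intervalIntegrable (by fun_prop) _ _
  rw [hsplit _ Real.continuous_cos, integral_sin_mul_cos₁] at hcos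
  rw [hsplit _ Real.continuous_sin] at hsin
  have hss : ∫ y in (0 : ℝ)..Real.pi, Real.sin y * Real.sin y = Real.pi / 2 := by
    simp only [← pow_two]
    rw [integral_sin_sq]; simp
  rw [hss] at hsin
  simp only [Real.sin_pi, Real.sin_zero, sub_self, zero_div, mul_zero, sub_zero] at hcos
  refine ⟨hK0, hcos.trans (mul_le_mul_of_nonneg_right (by nlinarith) hK0), ?_⟩
  set F := ∫ y in (0 : ℝ)..Real.pi, φ y * Real.sin y
  have hz2 : z ^ 2 ≤ 2 * F ^ 2 + 8 * K := by
    have h1 : (z * (Real.pi / 2)) ^ 2 ≤ 2 * F ^ 2 + 2 * (F - z * (Real.pi / 2)) ^ 2 := by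
      nlinarith [sq_nonneg (2 * F - z * (Real.pi / 2))]
    have h2 : z ^ 2 * Real.pi ^ 2 ≤ 8 * F ^ 2 + 8 * Real.pi ^ 2 * K := by nlinarith
    have h3 : (z ^ 2 - 8 * K) * Real.pi ^ 2 ≤ 8 * F ^ 2 := by nlinarith
    by_contra! hcon
    have h4 : 2 * F ^ 2 * Real.pi ^ 2 < (z ^ 2 - 8 * K) * Real.pi ^ 2 :=
      mul_lt_mul_of_pos_right (by linarith) (by positivity)
    nlinarith [mul_nonneg (sq_nonneg F) (by nlinarith : 0 ≤ Real.pi ^ 2 - 4)]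
  have hle : ∫ y in (0 : ℝ)..Real.pi, φ y ^ 2 ≤ ∫ y in (0 : ℝ)..Real.pi, (2 * z ^ 2 + 2 * K) := by
    refine intervalIntegral.integral_mono_on hpi.le (Continuous.intervalIntegrable (by fun_prop) _ _)
      (Continuous.intervalIntegrable (by fun_prop) _ _) fun y hy => ?_
    have h1 := hpt y hy
    have h2 : (z * Real.sin y) ^ 2 ≤ z ^ 2 := by
      rw [mul_pow]; nlinarith [Real.sin_sq_le_one y, sq_nonneg z]
    nlinarith [sq_nonneg (φ y - 2 * (z * Real.sin y))]
  rw [intervalIntegral.integral_const, smul_eq_mul, sub_zero] at hle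
  nlinarith [sq_nonneg F]

/-- If `f' + P h`, `h' - P f` and `h` are small, then so is `f`, provided that `P` is not: pairing the
second equation with `P` bounds `∫ P² f`, and `f` is nearly constant by the first equation. -/
theorem integral_sq_le_of_system {a b κ : ℝ} (hab : a ≤ b) (hκ0 : 0 ≤ κ) (hκ : κ ≤ 1)
    {f f' h h' P P' q : ℝ → ℝ}
    (hf : ∀ x, HasDerivAt f (f' x) x) (hf' : Continuous f')
    (hh : ∀ x, HasDerivAt h (h' x) x) (hh' : Continuous h')
    (hP : ∀ x, HasDerivAt P (P' x) x) (hP' : Continuous P') (hq : Continuous q)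
    (hPa : P a = 0) (hPb : P b = 0) (hPκ : ∀ x, |P x| ≤ κ) (hPκ' : ∀ x, |P' x| ≤ κ)
    (h1 : ∀ x, (f' x + P x * h x) ^ 2 ≤ 2 * q x) (h2 : ∀ x, (h' x - P x * f x) ^ 2 ≤ 2 * q x)
    (h3 : ∀ x, h x ^ 2 ≤ 10 * q x) (hS : 0 < ∫ x in a..b, P x ^ 2) :
    ∫ x in a..b, f x ^ 2 ≤
      48 * (b - a) ^ 2 * (κ ^ 2 / (∫ x in a..b, P x ^ 2) ^ 2 + 1) * ∫ x in a..b, q x := by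
  have hfc : Continuous f := continuous_iff_continuousAt.2 fun y => (hf y).continuousAt
  have hhc : Continuous h := continuous_iff_continuousAt.2 fun y => (hh y).continuousAt
  have hPc : Continuous P := continuous_iff_continuousAt.2 fun y => (hP y).continuousAt
  have hq0 : ∀ x, 0 ≤ q x := fun x => by nlinarith [h3 x, sq_nonneg (h x)]
  set S := ∫ x in a..b, P x ^ 2
  set X := ∫ x in a..b, q x
  set ℓ := b - a
  have hℓ : 0 ≤ ℓ := sub_nonneg.2 hab
  have hX : 0 ≤ X := intervalIntegral.integral_nonneg hab fun x _ => hq0 x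
  have hint : ∀ {t : ℝ → ℝ}, Continuous t → ∀ c d, IntervalIntegrable t volume c d :=
    fun ht c d => ht.intervalIntegrable c d
  have hPsq : ∀ x, P x ^ 2 ≤ κ ^ 2 := fun x => sq_le_sq' (abs_le.1 (hPκ x)).1 (abs_le.1 (hPκ x)).2
  have hPsq' : ∀ x, P' x ^ 2 ≤ κ ^ 2 := fun x =>
    sq_le_sq' (abs_le.1 (hPκ' x)).1 (abs_le.1 (hPκ' x)).2
  have hmono : ∀ {t : ℝ → ℝ} (c : ℝ), Continuous t → (∀ x, t x ≤ c * q x) →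
      ∫ x in a..b, t x ≤ c * X := fun {t} c ht hle => by
    rw [← intervalIntegral.integral_const_mul]
    exact intervalIntegral.integral_mono_on hab (hint ht _ _) (hint (by fun_prop) _ _)
      fun x _ => hle x
  have hconst : ∀ {t : ℝ → ℝ} (c : ℝ), Continuous t → (∀ x ∈ Icc a b, t x ≤ c) →
      ∫ x in a..b, t x ≤ ℓ * c := fun {t} c ht hle => by
    have := intervalIntegral.integral_mono_on hab (hint ht _ _)
      (hint (continuous_const (y := c)) _ _) hle
    simpa using this
  have hf'sq : ∫ x in a..b, f' x ^ 2 ≤ 24 * X := hmono 24 (by fun_prop) fun x => by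
    have e1 : (P x * h x) ^ 2 ≤ h x ^ 2 := by
      rw [mul_pow]
      have hκ1 : κ ^ 2 ≤ 1 := pow_le_one₀ hκ0 hκ
      exact mul_le_of_le_one_left (sq_nonneg _) ((hPsq x).trans hκ1)
    nlinarith [h1 x, h3 x, sq_nonneg (f' x + 2 * (P x * h x))]
  -- `f` varies little
  have hosc : ∀ u w, a ≤ u → u ≤ w → w ≤ b → (f w - f u) ^ 2 ≤ 24 * ℓ * X := by
    intro u w hau huw hwb
    have e1 : ∫ x in u..w, f' x * 1 = f w - f u := by
      simp only [mul_one]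
      exact intervalIntegral.integral_eq_sub_of_hasDerivAt (fun x _ => hf x) (hint hf' _ _)
    have e2 := sq_integral_mul_le huw hf' (continuous_const (y := (1 : ℝ)))
    rw [e1] at e2
    have e3 : ∫ x in u..w, f' x ^ 2 ≤ ∫ x in a..b, f' x ^ 2 :=
      intervalIntegral.integral_mono_interval hau huw hwb
        (Filter.Eventually.of_forall fun y => sq_nonneg (f' y)) (hint (by fun_prop) _ _)
    simp only [one_pow, intervalIntegral.integral_const, smul_eq_mul, mul_one] at e2
    calc (f w - f u) ^ 2 ≤ (∫ x in u..w, f' x ^ 2) * (w - u) := e2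
      _ ≤ 24 * X * ℓ := by
        have : w - u ≤ ℓ := by simp only [ℓ]; linarith
        exact mul_le_mul (e3.trans hf'sq) this (by linarith) (by positivity)
      _ = 24 * ℓ * X := by ring
  have hosc' : ∀ u ∈ Icc a b, ∀ w ∈ Icc a b, (f w - f u) ^ 2 ≤ 24 * ℓ * X := by
    intro u hu w hw
    rcases le_total u w with h | h
    · exact hosc u w hu.1 h hw.2
    · have := hosc w u hw.1 h hu.2
      nlinarith
  -- the weak form of the second equation
  set T1 := ∫ x in a..b, P' x * h x
  set T2 := ∫ x in a..b, P x * (h' x - P x * f x)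
  have hT1 : T1 ^ 2 ≤ (ℓ * κ ^ 2) * (10 * X) :=
    (sq_integral_mul_le hab hP' hhc).trans (mul_le_mul
      (hconst _ (by fun_prop) fun x _ => hPsq' x) (hmono 10 (by fun_prop) h3)
      (intervalIntegral.integral_nonneg hab fun x _ => sq_nonneg _) (by positivity))
  have hT2 : T2 ^ 2 ≤ (ℓ * κ ^ 2) * (2 * X) :=
    (sq_integral_mul_le hab hPc (by fun_prop)).trans (mul_le_mul
      (hconst _ (by fun_prop) fun x _ => hPsq x) (hmono 2 (by fun_prop) h2)
      (intervalIntegral.integral_nonneg hab fun x _ => sq_nonneg _) (by positivity))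
  have hweak : ∫ x in a..b, P x ^ 2 * f x = -T1 - T2 := by
    have e1 := intervalIntegral.integral_mul_deriv_eq_deriv_mul (fun x _ => hP x)
      (fun x _ => hh x) (hint hP' a b) (hint hh' a b)
    rw [hPa, hPb] at e1
    have e2 : T2 = (∫ x in a..b, P x * h' x) - ∫ x in a..b, P x ^ 2 * f x := by
      rw [← intervalIntegral.integral_sub (hint (by fun_prop) _ _) (hint (by fun_prop) _ _)]
      exact intervalIntegral.integral_congr fun x _ => by ring
    simp only [T1]
    linarith
  have hpt : ∀ x₀ ∈ Icc a b, f x₀ ^ 2 ≤ 48 * ℓ * (κ ^ 2 / S ^ 2 + 1) * X := by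
    intro x₀ hx₀
    set T3 := ∫ x in a..b, P x ^ 2 * (f x₀ - f x)
    have hsplit : S * f x₀ = -T1 - T2 + T3 := by
      have : T3 = S * f x₀ - ∫ x in a..b, P x ^ 2 * f x := by
        rw [← intervalIntegral.integral_mul_const,
          ← intervalIntegral.integral_sub (hint (by fun_prop) _ _) (hint (by fun_prop) _ _)]
        exact intervalIntegral.integral_congr fun x _ => by ring
      rw [this, hweak]; ring
    have hT3 : T3 ^ 2 ≤ S ^ 2 * (24 * ℓ * X) := by
      have e1 : |T3| ≤ ∫ x in a..b, P x ^ 2 * √(24 * ℓ * X) := by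
        refine (intervalIntegral.abs_integral_le_integral_abs hab).trans
          (intervalIntegral.integral_mono_on hab (hint (by fun_prop) _ _)
            (hint (by fun_prop) _ _) fun x hx => ?_)
        rw [abs_mul, abs_of_nonneg (sq_nonneg _)]
        gcongr
        exact Real.abs_le_sqrt (hosc' x hx x₀ hx₀)
      rw [intervalIntegral.integral_mul_const] at e1
      calc T3 ^ 2 = |T3| ^ 2 := (sq_abs _).symm
        _ ≤ (S * √(24 * ℓ * X)) ^ 2 := by gcongr
        _ = S ^ 2 * (24 * ℓ * X) := by rw [mul_pow, Real.sq_sqrt (by positivity)]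
    have e2 : S ^ 2 * f x₀ ^ 2 ≤ 48 * ℓ * X * (κ ^ 2 + S ^ 2) := by
      have : S ^ 2 * f x₀ ^ 2 = (-T1 - T2 + T3) ^ 2 := by rw [← hsplit]; ring
      rw [this]
      nlinarith [sq_nonneg (T1 - T2), sq_nonneg (T1 + T2 + T3)]
    have e3 : 48 * ℓ * (κ ^ 2 / S ^ 2 + 1) * X = 48 * ℓ * X * (κ ^ 2 + S ^ 2) / S ^ 2 := by
      field_simp
    rw [e3, le_div_iff₀ (by positivity)]
    linarith
  have := hconst _ (by fun_prop) hpt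
  calc ∫ x in a..b, f x ^ 2 ≤ _ := this
    _ = _ := by ring

theorem hasDerivAt_integral_of_continuous {F F' : ℝ → ℝ → ℝ} {a b : ℝ}
    (hF : Continuous F.uncurry) (hF' : Continuous F'.uncurry)
    (hd : ∀ x y, HasDerivAt (fun x => F x y) (F' x y) x) (x₀ : ℝ) :
    HasDerivAt (fun x => ∫ y in a..b, F x y) (∫ y in a..b, F' x₀ y) x₀ := by
  obtain ⟨C, hC⟩ := (isCompact_Icc.prod isCompact_uIcc :
    IsCompact (Icc (x₀ - 1) (x₀ + 1) ×ˢ uIcc a b)).exists_bound_of_continuousOn hF'.continuousOn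
  have hx : ∀ {H : ℝ → ℝ → ℝ}, Continuous H.uncurry → ∀ x, Continuous (H x) := fun hH x =>
    hH.comp (Continuous.prodMk_right x)
  refine (intervalIntegral.hasDerivAt_integral_of_dominated_loc_of_deriv_le
    (bound := fun _ => C) (Icc_mem_nhds (sub_one_lt x₀) (lt_add_one x₀))
    (Filter.Eventually.of_forall fun x => (hx hF x).aestronglyMeasurable)
    ((hx hF x₀).intervalIntegrable _ _) (hx hF' x₀).aestronglyMeasurable ?_
    intervalIntegrable_const ?_).2
  · refine Filter.Eventually.of_forall fun y hy x hx => ?_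
    exact hC (x, y) ⟨hx, uIoc_subset_uIcc hy⟩
  · exact Filter.Eventually.of_forall fun y _ x _ => hd x y

/-- The spectral gap of a block in the straightened coordinates: for functions on the strip
`[a, b] × (0, π)` that vanish near the top and the bottom, the quadratic form of the bent strip
dominates `‖v‖²` by a margin governed by the bending `P`. -/
theorem integral_strip_le {a b κ : ℝ} (hab : a ≤ b) (hκ0 : 0 ≤ κ) (hκ : κ ≤ 1)
    {v v₁ v₂ : ℝ → ℝ → ℝ} {P P' : ℝ → ℝ}
    (hv : Continuous v.uncurry) (hv₁ : Continuous v₁.uncurry) (hv₂ : Continuous v₂.uncurry)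
    (hd₁ : ∀ x y, HasDerivAt (fun x => v x y) (v₁ x y) x)
    (hd₂ : ∀ x y, HasDerivAt (v x) (v₂ x y) y)
    (hz : ∀ x, ∃ ε, 0 < ε ∧ ε < Real.pi / 2 ∧
      ∀ y, y < ε ∨ Real.pi - ε < y → v x y = 0 ∧ v₂ x y = 0)
    (hP : ∀ x, HasDerivAt P (P' x) x) (hP' : Continuous P')
    (hPa : P a = 0) (hPb : P b = 0) (hPκ : ∀ x, |P x| ≤ κ) (hPκ' : ∀ x, |P' x| ≤ κ)
    (hS : 0 < ∫ x in a..b, P x ^ 2) :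
    ∫ x in a..b, ∫ y in (0 : ℝ)..Real.pi, v x y ^ 2 ≤
      (672 * (b - a) ^ 2 * (κ ^ 2 / (∫ x in a..b, P x ^ 2) ^ 2 + 1) + 60) *
        ∫ x in a..b, ((∫ y in (0 : ℝ)..Real.pi, (v₁ x y - P x * v₂ x y) ^ 2) +
          ∫ y in (0 : ℝ)..Real.pi, (v₂ x y ^ 2 - v x y ^ 2)) := by
  have hpi := Real.pi_pos
  have hPc : Continuous P := continuous_iff_continuousAt.2 fun y => (hP y).continuousAt
  have hx : ∀ {H : ℝ → ℝ → ℝ}, Continuous H.uncurry → ∀ x, Continuous (H x) := fun hH x =>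
    hH.comp (Continuous.prodMk_right x)
  have hpar : ∀ {H : ℝ → ℝ → ℝ}, Continuous H.uncurry →
      Continuous fun x => ∫ y in (0 : ℝ)..Real.pi, H x y := fun hH =>
    intervalIntegral.continuous_parametric_intervalIntegral_of_continuous' hH _ _
  have hvy : ∀ {H : ℝ → ℝ → ℝ} {t : ℝ → ℝ}, Continuous H.uncurry → Continuous t →
      Continuous (fun x y => H x y * t y).uncurry := fun {H t} hH ht =>
    hH.mul (ht.comp continuous_snd)
  have hRc : Continuous (fun x y => v₁ x y - P x * v₂ x y).uncurry :=
    hv₁.sub ((hPc.comp continuous_fst).mul hv₂)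
  set K : ℝ → ℝ := fun x => ∫ y in (0 : ℝ)..Real.pi, (v₂ x y ^ 2 - v x y ^ 2) with hK
  set R : ℝ → ℝ := fun x => ∫ y in (0 : ℝ)..Real.pi, (v₁ x y - P x * v₂ x y) ^ 2 with hR
  have hKc : Continuous K := hpar (H := fun x y => v₂ x y ^ 2 - v x y ^ 2)
    ((hv₂.pow 2).sub (hv.pow 2))
  have hRc2 : Continuous R := hpar (H := fun x y => (v₁ x y - P x * v₂ x y) ^ 2) (hRc.pow 2)
  have hR0 : ∀ x, 0 ≤ R x := fun x =>
    intervalIntegral.integral_nonneg hpi.le fun y _ => sq_nonneg _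
  set f : ℝ → ℝ := fun x => ∫ y in (0 : ℝ)..Real.pi, v x y * Real.sin y with hf
  set h : ℝ → ℝ := fun x => ∫ y in (0 : ℝ)..Real.pi, v x y * Real.cos y with hh
  have hfibre : ∀ x, 0 ≤ K x ∧ h x ^ 2 ≤ 10 * K x ∧
      ∫ y in (0 : ℝ)..Real.pi, v x y ^ 2 ≤ 14 * f x ^ 2 + 60 * K x := fun x => by
    obtain ⟨ε, h1, h2, h3⟩ := hz x
    exact fibre_estimates (hd₂ x) (hx hv₂ x) h1 h2 h3 rfl
  have hend : ∀ x, v x 0 = 0 ∧ v x Real.pi = 0 := fun x => by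
    obtain ⟨ε, h1, h2, h3⟩ := hz x
    exact ⟨(h3 0 (Or.inl h1)).1, (h3 _ (Or.inr (by linarith))).1⟩
  have hdf := hasDerivAt_integral_of_continuous (a := 0) (b := Real.pi)
    (hvy hv Real.continuous_sin) (hvy hv₁ Real.continuous_sin)
    fun x y => (hd₁ x y).mul_const (Real.sin y)
  have hdh := hasDerivAt_integral_of_continuous (a := 0) (b := Real.pi)
    (hvy hv Real.continuous_cos) (hvy hv₁ Real.continuous_cos)
    fun x y => (hd₁ x y).mul_const (Real.cos y)
  have hintx : ∀ {t : ℝ → ℝ}, Continuous t → IntervalIntegrable t volume 0 Real.pi :=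
    fun ht => ht.intervalIntegrable _ _
  -- pairing with `sin` and with `cos`, and integration by parts in `y`
  have hsin : ∀ x, (∫ y in (0 : ℝ)..Real.pi, v₁ x y * Real.sin y) + P x * h x =
      ∫ y in (0 : ℝ)..Real.pi, (v₁ x y - P x * v₂ x y) * Real.sin y := fun x => by
    have c1 := hx hv₁ x
    have c2 := hx hv₂ x
    have e1 := intervalIntegral.integral_mul_deriv_eq_deriv_mul (a := 0) (b := Real.pi)
      (fun y _ => Real.hasDerivAt_sin y) (fun y _ => hd₂ x y)
      (hintx Real.continuous_cos) (hintx c2)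
    rw [(hend x).1, (hend x).2] at e1
    have e2 : ∫ y in (0 : ℝ)..Real.pi, (v₁ x y - P x * v₂ x y) * Real.sin y =
        (∫ y in (0 : ℝ)..Real.pi, v₁ x y * Real.sin y) -
          P x * ∫ y in (0 : ℝ)..Real.pi, Real.sin y * v₂ x y := by
      rw [← intervalIntegral.integral_const_mul, ← intervalIntegral.integral_sub
        (hintx (by fun_prop)) (hintx (by fun_prop))]
      congr 1; ext y; ring
    have e3 : h x = ∫ y in (0 : ℝ)..Real.pi, Real.cos y * v x y := by
      simp only [hh, mul_comm]
    rw [e2, e1, e3]; ring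
  have hcos : ∀ x, (∫ y in (0 : ℝ)..Real.pi, v₁ x y * Real.cos y) - P x * f x =
      ∫ y in (0 : ℝ)..Real.pi, (v₁ x y - P x * v₂ x y) * Real.cos y := fun x => by
    have c1 := hx hv₁ x
    have c2 := hx hv₂ x
    have e1 := intervalIntegral.integral_mul_deriv_eq_deriv_mul (a := 0) (b := Real.pi)
      (fun y _ => Real.hasDerivAt_cos y) (fun y _ => hd₂ x y)
      (hintx Real.continuous_sin.neg) (hintx c2)
    rw [(hend x).1, (hend x).2] at e1
    have e2 : ∫ y in (0 : ℝ)..Real.pi, (v₁ x y - P x * v₂ x y) * Real.cos y =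
        (∫ y in (0 : ℝ)..Real.pi, v₁ x y * Real.cos y) -
          P x * ∫ y in (0 : ℝ)..Real.pi, Real.cos y * v₂ x y := by
      rw [← intervalIntegral.integral_const_mul, ← intervalIntegral.integral_sub
        (hintx (by fun_prop)) (hintx (by fun_prop))]
      congr 1; ext y; ring
    have e3 : ∫ y in (0 : ℝ)..Real.pi, -Real.sin y * v x y = -f x := by
      rw [hf, ← intervalIntegral.integral_neg]
      congr 1; ext y; ring
    rw [e2, e1, e3]; ring
  have hpair : ∀ t : ℝ → ℝ, Continuous t → ∫ y in (0 : ℝ)..Real.pi, t y ^ 2 ≤ 2 → ∀ x,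
      (∫ y in (0 : ℝ)..Real.pi, (v₁ x y - P x * v₂ x y) * t y) ^ 2 ≤ 2 * (R x + K x) := by
    intro t ht ht2 x
    have := sq_integral_mul_le hpi.le (hx hRc x) ht
    calc _ ≤ R x * ∫ y in (0 : ℝ)..Real.pi, t y ^ 2 := this
      _ ≤ R x * 2 := mul_le_mul_of_nonneg_left ht2 (hR0 x)
      _ ≤ 2 * (R x + K x) := by linarith [(hfibre x).1]
  have hpi4 : Real.pi ≤ 4 := Real.pi_le_four
  have main := integral_sq_le_of_system (q := fun x => R x + K x) hab hκ0 hκ hdf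
    (hpar (hvy hv₁ Real.continuous_sin)) hdh (hpar (hvy hv₁ Real.continuous_cos)) hP hP'
    (hRc2.add hKc) hPa hPb hPκ hPκ'
    (fun x => by
      have := hpair Real.sin Real.continuous_sin (by rw [integral_sin_sq]; simp; linarith) x
      rwa [← hsin] at this)
    (fun x => by
      have := hpair Real.cos Real.continuous_cos (by rw [integral_cos_sq]; simp; linarith) x
      rwa [← hcos] at this)
    (fun x => by linarith [(hfibre x).2.1, hR0 x]) hS
  have hvsq : Continuous fun p : ℝ × ℝ => v.uncurry p ^ 2 := by fun_prop
  have hfc : Continuous f := hpar (hvy hv Real.continuous_sin)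
  have hle : ∫ x in a..b, ∫ y in (0 : ℝ)..Real.pi, v x y ^ 2 ≤
      ∫ x in a..b, (14 * f x ^ 2 + 60 * (R x + K x)) := by
    refine intervalIntegral.integral_mono_on hab
      ((hpar (H := fun x y => v x y ^ 2) hvsq).intervalIntegrable _ _)
      (Continuous.intervalIntegrable (by fun_prop) _ _) fun x _ => ?_
    linarith [(hfibre x).2.2, hR0 x]
  rw [intervalIntegral.integral_add (Continuous.intervalIntegrable (by fun_prop) _ _)
    (Continuous.intervalIntegrable (by fun_prop) _ _), intervalIntegral.integral_const_mul,
    intervalIntegral.integral_const_mul] at hle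
  calc _ ≤ _ := hle
    _ ≤ 14 * (48 * (b - a) ^ 2 * (κ ^ 2 / (∫ x in a..b, P x ^ 2) ^ 2 + 1) *
          ∫ x in a..b, (R x + K x)) + 60 * ∫ x in a..b, (R x + K x) := by gcongr
    _ = _ := by ring

/-! ### Straightening the strip -/

/-- The point of the plane with coordinates `x` and `y`. -/
def point (x y : ℝ) : Plane :=
  x • EuclideanSpace.single 0 (1 : ℝ) + y • EuclideanSpace.single 1 (1 : ℝ)

@[simp] theorem point_zero (x y : ℝ) : point x y 0 = x := by simp [point]

@[simp] theorem point_one (x y : ℝ) : point x y 1 = y := by simp [point]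

theorem point_eq_toLp (p : ℝ × ℝ) :
    point p.1 p.2 = (MeasurableEquiv.toLp 2 (Fin 2 → ℝ)) (MeasurableEquiv.finTwoArrow.symm p) := by
  ext i
  fin_cases i
  · simp [point]
  · simp [point]

theorem measurePreserving_point : MeasurePreserving fun p : ℝ × ℝ => point p.1 p.2 := by
  simp only [point_eq_toLp]
  exact (EuclideanSpace.volume_preserving_symm_measurableEquiv_toLp (Fin 2)).symm.comp
    (volume_preserving_finTwoArrow ℝ).symm

theorem measurableEmbedding_point : MeasurableEmbedding fun p : ℝ × ℝ => point p.1 p.2 := by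
  simp only [point_eq_toLp]
  exact (MeasurableEquiv.toLp 2 (Fin 2 → ℝ)).measurableEmbedding.comp
    MeasurableEquiv.finTwoArrow.symm.measurableEmbedding

theorem hasDerivAt_point_left {Γ Γ' : ℝ → ℝ} (hΓ : ∀ x, HasDerivAt Γ (Γ' x) x) (x y : ℝ) :
    HasDerivAt (fun x => point x (y + Γ x))
      (EuclideanSpace.single 0 (1 : ℝ) + Γ' x • EuclideanSpace.single 1 (1 : ℝ)) x := by
  refine (((hasDerivAt_id x).smul_const (EuclideanSpace.single (0 : Fin 2) (1 : ℝ))).add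
    (((hΓ x).const_add y).smul_const (EuclideanSpace.single (1 : Fin 2) (1 : ℝ)))).congr_deriv ?_
  rw [one_smul]

theorem hasDerivAt_point_right (x y s : ℝ) :
    HasDerivAt (fun y => point x (y + s)) (EuclideanSpace.single 1 (1 : ℝ)) y := by
  refine ((((hasDerivAt_id y).add_const s).smul_const
    (EuclideanSpace.single (1 : Fin 2) (1 : ℝ))).const_add
      (x • EuclideanSpace.single (0 : Fin 2) (1 : ℝ))).congr_deriv ?_
  rw [one_smul]

/-- The strip of height `π` above the graph of `Γ`. -/
def strip (Γ : ℝ → ℝ) : Set Plane := {x | Γ (x 0) < x 1 ∧ x 1 < Γ (x 0) + Real.pi}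

/-- The integral over a segment of the strip in the straightened coordinates `(x, y + Γ x)`. -/
theorem integral_segment_eq {Γ : ℝ → ℝ} {L : ℝ} (hL : 0 ≤ L) {F : Plane → ℝ}
    (hF : Continuous F) (hFc : HasCompactSupport F) (hFs : ∀ p ∉ strip Γ, F p = 0) :
    ∫ p in {x : Plane | 0 < x 0 ∧ x 0 < L} ∩ strip Γ, F p =
      ∫ x in (0 : ℝ)..L, ∫ y in (0 : ℝ)..Real.pi, F (point x (y + Γ x)) := by
  have hint : Integrable (fun p : ℝ × ℝ => F (point p.1 p.2)) :=
    (measurePreserving_point.integrable_comp_emb measurableEmbedding_point).2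
      (hF.integrable_of_hasCompactSupport hFc)
  rw [← measurePreserving_point.setIntegral_preimage_emb measurableEmbedding_point]
  have h1 : ∫ p in (fun p : ℝ × ℝ => point p.1 p.2) ⁻¹'
      ({x : Plane | 0 < x 0 ∧ x 0 < L} ∩ strip Γ), F (point p.1 p.2) =
      ∫ p in Ioo 0 L ×ˢ univ, F (point p.1 p.2) := by
    refine (setIntegral_eq_of_subset_of_forall_sdiff_eq_zero
      (measurableSet_Ioo.prod MeasurableSet.univ) ?_ ?_).symm
    · rintro ⟨x, y⟩ hxy
      have := hxy.1
      simp only [mem_ofPred_eq, point_zero] at this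
      exact ⟨this, mem_univ _⟩
    · rintro ⟨x, y⟩ ⟨h1, h2⟩
      refine hFs _ fun h3 => h2 ⟨?_, h3⟩
      simpa using h1.1
  rw [h1, Measure.volume_eq_prod, setIntegral_prod _ (by
    rw [← Measure.volume_eq_prod]; exact hint.integrableOn),
    intervalIntegral.integral_of_le hL, ← integral_Ioc_eq_integral_Ioo]
  refine setIntegral_congr_fun measurableSet_Ioc fun x _ => ?_
  simp only
  rw [setIntegral_univ, ← integral_add_right_eq_self _ (Γ x),
    intervalIntegral.integral_of_le Real.pi_pos.le, integral_Ioc_eq_integral_Ioo,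
    setIntegral_eq_integral_of_forall_compl_eq_zero]
  intro y hy
  refine hFs _ fun h => hy ?_
  simp only [strip, mem_ofPred_eq, point_zero, point_one] at h
  exact ⟨by linarith [h.1], by linarith [h.2]⟩

theorem vanish_near_ends {Γ : ℝ → ℝ} {φ : Plane → ℝ} (hs : tsupport φ ⊆ strip Γ) (x : ℝ) :
    ∃ ε, 0 < ε ∧ ε < Real.pi / 2 ∧ ∀ y, y < ε ∨ Real.pi - ε < y →
      φ (point x (y + Γ x)) = 0 ∧
        fderiv ℝ φ (point x (y + Γ x)) (EuclideanSpace.single 1 1) = 0 := by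
  have hpi := Real.pi_pos
  set C : Set ℝ := {y | point x (y + Γ x) ∈ tsupport φ} with hC
  have hcl : IsClosed C := (isClosed_tsupport φ).preimage (by unfold point; fun_prop)
  have hsub : C ⊆ Ioo 0 Real.pi := fun y hy => by
    have := hs hy
    simp only [strip, mem_ofPred_eq, point_zero, point_one] at this
    exact ⟨by linarith [this.1], by linarith [this.2]⟩
  obtain ⟨ε₁, h1, h1'⟩ := Metric.isOpen_iff.1 hcl.isOpen_compl 0 fun h => lt_irrefl _ (hsub h).1
  obtain ⟨ε₂, h2, h2'⟩ := Metric.isOpen_iff.1 hcl.isOpen_compl Real.pi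
    fun h => lt_irrefl _ (hsub h).2
  refine ⟨min (min ε₁ ε₂) (Real.pi / 4), by positivity, (min_le_right _ _).trans_lt (by linarith),
    fun y hy => ?_⟩
  have hyC : y ∉ C := by
    intro hyC
    have h3 := hsub hyC
    rcases hy with hy | hy
    · refine h1' ?_ hyC
      rw [Metric.mem_ball, Real.dist_eq, sub_zero, abs_of_pos h3.1]
      exact hy.trans_le ((min_le_left _ _).trans (min_le_left _ _))
    · refine h2' ?_ hyC
      rw [Metric.mem_ball, Real.dist_eq, abs_sub_comm, abs_of_pos (by linarith [h3.2])]
      have : min (min ε₁ ε₂) (Real.pi / 4) ≤ ε₂ := (min_le_left _ _).trans (min_le_right _ _)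
      linarith
  refine ⟨image_eq_zero_of_notMem_tsupport hyC, ?_⟩
  rw [fderiv_of_notMem_tsupport ℝ hyC]
  rfl

/-- The form bound for real test functions, for a strip that is cut into blocks on each of which the
slope of its bottom carries enough `L²`-mass. -/
theorem form_bound_real {Γ P P' : ℝ → ℝ} {κ M δ : ℝ} {c : ℕ → ℝ} {m : ℕ}
    (hκ0 : 0 ≤ κ) (hκ : κ ≤ 1) (hΓ : ∀ x, HasDerivAt Γ (P x) x) (hP : ∀ x, HasDerivAt P (P' x) x)
    (hP' : Continuous P') (hPκ : ∀ x, |P x| ≤ κ) (hPκ' : ∀ x, |P' x| ≤ κ)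
    (hc0 : c 0 = 0) (hc : ∀ j < m, c j ≤ c (j + 1)) (hPc : ∀ j, P (c j) = 0)
    (hL : 0 ≤ c m)
    (hS : ∀ j < m, 0 < ∫ x in c j..c (j + 1), P x ^ 2)
    (hM : ∀ j < m, 672 * (c (j + 1) - c j) ^ 2 *
      (κ ^ 2 / (∫ x in c j..c (j + 1), P x ^ 2) ^ 2 + 1) + 60 ≤ M)
    (hδ0 : 0 ≤ δ) (hδ : δ * M ≤ 1) {φ : Plane → ℝ} (hφ : ContDiff ℝ (⊤ : ℕ∞) φ)
    (hφc : HasCompactSupport φ) (hφs : tsupport φ ⊆ strip Γ) :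
    (1 + δ) * ∫ p in {x : Plane | 0 < x 0 ∧ x 0 < c m} ∩ strip Γ, φ p ^ 2 ≤
      (∫ p in {x : Plane | 0 < x 0 ∧ x 0 < c m} ∩ strip Γ,
          fderiv ℝ φ p (EuclideanSpace.single 0 1) ^ 2) +
        ∫ p in {x : Plane | 0 < x 0 ∧ x 0 < c m} ∩ strip Γ,
          fderiv ℝ φ p (EuclideanSpace.single 1 1) ^ 2 := by
  have hpi := Real.pi_pos
  have hΓc : Continuous Γ := continuous_iff_continuousAt.2 fun y => (hΓ y).continuousAt
  have hPcont : Continuous P := continuous_iff_continuousAt.2 fun y => (hP y).continuousAt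
  have hφcont : Continuous φ := hφ.continuous
  have hdφ : ∀ e : Plane, Continuous fun p => fderiv ℝ φ p e := fun e =>
    (hφ.continuous_fderiv (by simp)).clm_apply continuous_const
  have hφd : ∀ p, HasFDerivAt φ (fderiv ℝ φ p) p := fun p =>
    (hφ.differentiable (by simp) p).hasFDerivAt
  have hpt : Continuous fun q : ℝ × ℝ => point q.1 (q.2 + Γ q.1) := by unfold point; fun_prop
  set e0 : Plane := EuclideanSpace.single 0 (1 : ℝ)
  set e1 : Plane := EuclideanSpace.single 1 (1 : ℝ)
  set v : ℝ → ℝ → ℝ := fun x y => φ (point x (y + Γ x)) with hv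
  set d₁ : ℝ → ℝ → ℝ := fun x y => fderiv ℝ φ (point x (y + Γ x)) e0 with hd₁
  set v₂ : ℝ → ℝ → ℝ := fun x y => fderiv ℝ φ (point x (y + Γ x)) e1 with hv₂
  set v₁ : ℝ → ℝ → ℝ := fun x y => d₁ x y + P x * v₂ x y with hv₁
  have cv : Continuous v.uncurry := hφcont.comp hpt
  have cd₁ : Continuous d₁.uncurry := (hdφ e0).comp hpt
  have cv₂ : Continuous v₂.uncurry := (hdφ e1).comp hpt
  have cv₁ : Continuous v₁.uncurry := cd₁.add ((hPcont.comp continuous_fst).mul cv₂)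
  have dv₁ : ∀ x y, HasDerivAt (fun x => v x y) (v₁ x y) x := fun x y => by
    have := (hφd (point x (y + Γ x))).comp_hasDerivAt x (hasDerivAt_point_left hΓ x y)
    refine this.congr_deriv ?_
    simp [hv₁, hd₁, hv₂, e0, e1]
  have dv₂ : ∀ x y, HasDerivAt (v x) (v₂ x y) y := fun x y =>
    (hφd (point x (y + Γ x))).comp_hasDerivAt y (hasDerivAt_point_right x y (Γ x))
  have hpar : ∀ {H : ℝ → ℝ → ℝ}, Continuous H.uncurry →
      Continuous fun x => ∫ y in (0 : ℝ)..Real.pi, H x y := fun hH =>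
    intervalIntegral.continuous_parametric_intervalIntegral_of_continuous' hH _ _
  have sq_cont : ∀ {H : ℝ → ℝ → ℝ}, Continuous H.uncurry →
      Continuous (fun x y => H x y ^ 2).uncurry := fun {H} hH => by
    have : Continuous fun p : ℝ × ℝ => H.uncurry p ^ 2 := by fun_prop
    exact this
  have hx : ∀ {H : ℝ → ℝ → ℝ}, Continuous H.uncurry → ∀ x, Continuous (H x) := fun hH x =>
    hH.comp (Continuous.prodMk_right x)
  set A : ℝ → ℝ := fun x => ∫ y in (0 : ℝ)..Real.pi, v x y ^ 2 with hA
  set B₁ : ℝ → ℝ := fun x => ∫ y in (0 : ℝ)..Real.pi, d₁ x y ^ 2 with hB₁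
  set B₂ : ℝ → ℝ := fun x => ∫ y in (0 : ℝ)..Real.pi, v₂ x y ^ 2 with hB₂
  have cA : Continuous A := hpar (sq_cont cv)
  have cB₁ : Continuous B₁ := hpar (sq_cont cd₁)
  have cB₂ : Continuous B₂ := hpar (sq_cont cv₂)
  have hblock : ∀ j < m, δ * ∫ x in c j..c (j + 1), A x ≤
      ∫ x in c j..c (j + 1), (B₁ x + (B₂ x - A x)) := by
    intro j hj
    have key := integral_strip_le (hc j hj) hκ0 hκ cv cv₁ cv₂ dv₁ dv₂ (vanish_near_ends hφs) hP hP'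
      (hPc j) (hPc (j + 1)) hPκ hPκ' (hS j hj)
    have e : ∀ x, (∫ y in (0 : ℝ)..Real.pi, (v₁ x y - P x * v₂ x y) ^ 2) +
        ∫ y in (0 : ℝ)..Real.pi, (v₂ x y ^ 2 - v x y ^ 2) = B₁ x + (B₂ x - A x) := fun x => by
      rw [intervalIntegral.integral_sub ((hx (sq_cont cv₂) x).intervalIntegrable _ _)
        ((hx (sq_cont cv) x).intervalIntegrable _ _)]
      simp only [hv₁, hB₁, hB₂, hA, add_sub_cancel_right]
    simp only [e] at key
    set X := ∫ x in c j..c (j + 1), (B₁ x + (B₂ x - A x))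
    have hA0 : 0 ≤ ∫ x in c j..c (j + 1), A x := intervalIntegral.integral_nonneg (hc j hj)
      fun x _ => intervalIntegral.integral_nonneg hpi.le fun y _ => sq_nonneg _
    have hMj := hM j hj
    have hMpos : 0 < 672 * (c (j + 1) - c j) ^ 2 *
      (κ ^ 2 / (∫ x in c j..c (j + 1), P x ^ 2) ^ 2 + 1) + 60 := by positivity
    have hX : 0 ≤ X := by
      by_contra! hneg
      have := mul_neg_of_pos_of_neg hMpos hneg
      exact absurd (hA0.trans key) (not_le.2 this)
    calc δ * ∫ x in c j..c (j + 1), A x ≤ δ * (M * X) := by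
          gcongr
          exact key.trans (mul_le_mul_of_nonneg_right hMj hX)
      _ = (δ * M) * X := by ring
      _ ≤ 1 * X := by gcongr
      _ = X := one_mul X
  have hsum := Finset.sum_le_sum fun j (hj : j ∈ Finset.range m) =>
    hblock j (Finset.mem_range.1 hj)
  rw [← Finset.mul_sum, intervalIntegral.sum_integral_adjacent_intervals
      fun k _ => cA.intervalIntegrable _ _,
    intervalIntegral.sum_integral_adjacent_intervals
      fun k _ => Continuous.intervalIntegrable (by fun_prop) _ _, hc0,
    intervalIntegral.integral_add (cB₁.intervalIntegrable _ _)
      (Continuous.intervalIntegrable (by fun_prop) _ _),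
    intervalIntegral.integral_sub (cB₂.intervalIntegrable _ _) (cA.intervalIntegrable _ _)] at hsum
  have hzero : ∀ p ∉ strip Γ, φ p = 0 ∧ fderiv ℝ φ p = 0 := fun p hp =>
    ⟨image_eq_zero_of_notMem_tsupport fun h => hp (hφs h),
      fderiv_of_notMem_tsupport ℝ fun h => hp (hφs h)⟩
  have hdc : ∀ e : Plane, HasCompactSupport fun p => fderiv ℝ φ p e := fun e =>
    hφc.fderiv_apply ℝ e
  rw [integral_segment_eq hL (F := fun p => φ p ^ 2) (by fun_prop)
      (hφc.comp_left (g := fun t => t ^ 2) (by simp)) fun p hp => by simp [(hzero p hp).1],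
    integral_segment_eq hL (F := fun p => fderiv ℝ φ p e0 ^ 2) ((hdφ e0).pow 2)
      ((hdc e0).comp_left (g := fun t => t ^ 2) (by simp)) fun p hp => by simp [(hzero p hp).2],
    integral_segment_eq hL (F := fun p => fderiv ℝ φ p e1 ^ 2) ((hdφ e1).pow 2)
      ((hdc e1).comp_left (g := fun t => t ^ 2) (by simp)) fun p hp => by simp [(hzero p hp).2]]
  linarith

/-- The complex form bound follows from the real one, applied to the real and imaginary parts. -/
theorem form_bound_complex {D U : Set Plane} {δ : ℝ}
    (hreal : ∀ φ : Plane → ℝ, ContDiff ℝ (⊤ : ℕ∞) φ → HasCompactSupport φ → tsupport φ ⊆ U →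
      (1 + δ) * ∫ p in D, φ p ^ 2 ≤ (∫ p in D, fderiv ℝ φ p (EuclideanSpace.single 0 1) ^ 2) +
        ∫ p in D, fderiv ℝ φ p (EuclideanSpace.single 1 1) ^ 2)
    {φ : Plane → ℂ} (hφ : ContDiff ℝ (⊤ : ℕ∞) φ) (hφc : HasCompactSupport φ)
    (hφs : tsupport φ ⊆ U) :
    (1 + δ) * ∫ p in D, ‖φ p‖ ^ 2 ≤ (∫ p in D, ‖fderiv ℝ φ p (EuclideanSpace.single 0 1)‖ ^ 2) +
      ∫ p in D, ‖fderiv ℝ φ p (EuclideanSpace.single 1 1)‖ ^ 2 := by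
  have hφd : ∀ p, HasFDerivAt φ (fderiv ℝ φ p) p := fun p =>
    (hφ.differentiable (by simp) p).hasFDerivAt
  have hdφ : ∀ e : Plane, Continuous fun p => fderiv ℝ φ p e := fun e =>
    (hφ.continuous_fderiv (by simp)).clm_apply continuous_const
  have hsub : ∀ T : ℂ →L[ℝ] ℝ, tsupport (fun p => T (φ p)) ⊆ U := fun T =>
    (closure_mono (fun p hp => by
      simp only [Function.mem_support, ne_eq] at hp ⊢
      exact fun h => hp (by rw [h, map_zero]))).trans hφs
  have hfd : ∀ (T : ℂ →L[ℝ] ℝ) (p e : Plane),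
      fderiv ℝ (fun p => T (φ p)) p e = T (fderiv ℝ φ p e) := fun T p e => by
    have := (T.hasFDerivAt.comp p (hφd p)).fderiv
    exact DFunLike.congr_fun this e
  have key : ∀ T : ℂ →L[ℝ] ℝ, _ := fun T => hreal (fun p => T (φ p)) (T.contDiff.comp hφ)
    (hφc.comp_left (map_zero T)) (hsub T)
  simp only [hfd] at key
  have hre := key Complex.reCLM
  have him := key Complex.imCLM
  simp only [Complex.reCLM_apply, Complex.imCLM_apply] at hre him
  have hsplit : ∀ ψ : Plane → ℂ, Continuous ψ → HasCompactSupport ψ →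
      ∫ p in D, ‖ψ p‖ ^ 2 = (∫ p in D, (ψ p).re ^ 2) + ∫ p in D, (ψ p).im ^ 2 := by
    intro ψ hψ hψc
    rw [← integral_add]
    · refine integral_congr_ae (Filter.Eventually.of_forall fun p => ?_)
      simp only
      rw [← Complex.normSq_eq_norm_sq, Complex.normSq_apply]; ring
    · exact (Continuous.integrable_of_hasCompactSupport (by fun_prop)
        (hψc.comp_left (g := fun z : ℂ => z.re ^ 2) (by simp))).integrableOn
    · exact (Continuous.integrable_of_hasCompactSupport (by fun_prop)
        (hψc.comp_left (g := fun z : ℂ => z.im ^ 2) (by simp))).integrableOn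
  rw [hsplit φ hφ.continuous hφc, hsplit _ (hdφ _) (hφc.fderiv_apply ℝ _),
    hsplit _ (hdφ _) (hφc.fderiv_apply ℝ _)]
  linarith

theorem norm_sq_eq_integral {D : Set Plane} (f : L2 D) : ‖f‖ ^ 2 = ∫ p in D, ‖f p‖ ^ 2 := by
  have h : ((‖f‖ ^ 2 : ℝ) : ℂ) = ((∫ p in D, ‖f p‖ ^ 2 : ℝ) : ℂ) := by
    have := inner_self_eq_norm_sq_to_K (𝕜 := ℂ) f
    rw [← integral_complex_ofReal, Complex.ofReal_pow]
    refine this.symm.trans ?_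
    rw [L2.inner_def]
    refine integral_congr_ae (Filter.Eventually.of_forall fun p => ?_)
    simp only
    rw [inner_self_eq_norm_sq_to_K]
    norm_cast
  exact_mod_cast h

theorem smul_mem_testGraph {D U : Set Plane} {c : ℂ} {w : L2 D × (Fin 2 → L2 D)}
    (hw : w ∈ testGraph D U) : c • w ∈ testGraph D U := by
  obtain ⟨φ, h1, h2, h3, h4, h5⟩ := hw
  refine ⟨c • φ, h1.const_smul c, h2.smul_left (f := fun _ => c), ?_, ?_, fun i => ?_⟩
  · exact (closure_mono (Function.support_const_smul_subset c φ)).trans h3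
  · filter_upwards [Lp.coeFn_smul c w.1, h4] with x hx hx'
    simp only [Prod.smul_fst]
    rw [hx, Pi.smul_apply, Pi.smul_apply, hx']
  · filter_upwards [Lp.coeFn_smul c (w.2 i), h5 i] with x hx hx'
    simp only [Prod.smul_snd, Pi.smul_apply] at hx ⊢
    rw [hx, hx', fderiv_const_smul (h1.differentiable (by simp) x)]
    rfl

theorem add_mem_testGraph {D U : Set Plane} {w w' : L2 D × (Fin 2 → L2 D)}
    (hw : w ∈ testGraph D U) (hw' : w' ∈ testGraph D U) : w + w' ∈ testGraph D U := by
  obtain ⟨φ, h1, h2, h3, h4, h5⟩ := hw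
  obtain ⟨ψ, h1', h2', h3', h4', h5'⟩ := hw'
  refine ⟨φ + ψ, h1.add h1', h2.add h2', ?_, ?_, fun i => ?_⟩
  · exact (tsupport_add φ ψ).trans (union_subset h3 h3')
  · filter_upwards [Lp.coeFn_add w.1 w'.1, h4, h4'] with x hx e e'
    simp only [Prod.fst_add]
    rw [hx, Pi.add_apply, Pi.add_apply, e, e']
  · filter_upwards [Lp.coeFn_add (w.2 i) (w'.2 i), h5 i, h5' i] with x hx e e'
    simp only [Prod.snd_add, Pi.add_apply] at hx ⊢
    rw [hx, e, e', fderiv_add (h1.differentiable (by simp) x) (h1'.differentiable (by simp) x)]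
    rfl

/-- A closed property of pairs `(u, ∇u)` holds on the form domain if it holds for test functions. -/
theorem formDomainGraph_induction {D U : Set Plane} {p : L2 D × (Fin 2 → L2 D) → Prop}
    (hclosed : IsClosed {w | p w}) (h0 : p 0) (htest : ∀ w ∈ testGraph D U, p w)
    {w : L2 D × (Fin 2 → L2 D)} (hw : w ∈ formDomainGraph D U) : p w := by
  have hsub : ((Submodule.span ℂ (testGraph D U) : Submodule ℂ _) : Set _) ⊆ {w | p w} := by
    intro w hw
    have : w = 0 ∨ w ∈ testGraph D U := by
      refine Submodule.span_induction (fun x hx => Or.inr hx) (Or.inl rfl) ?_ ?_ hw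
      · rintro x y - - (rfl | hx) (rfl | hy)
        · exact Or.inl (add_zero _)
        · exact Or.inr (by rwa [zero_add])
        · exact Or.inr (by rwa [add_zero])
        · exact Or.inr (add_mem_testGraph hx hy)
      · rintro c x - (rfl | hx)
        · exact Or.inl (smul_zero _)
        · exact Or.inr (smul_mem_testGraph hx)
    rcases this with rfl | h
    · exact h0
    · exact htest w h
  exact closure_minimal hsub hclosed hw

/-- The form bound passes from test functions to the form domain. -/
theorem form_bound_of_test {D U : Set Plane} {δ : ℝ}
    (h : ∀ φ : Plane → ℂ, ContDiff ℝ (⊤ : ℕ∞) φ → HasCompactSupport φ → tsupport φ ⊆ U →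
      (1 + δ) * ∫ p in D, ‖φ p‖ ^ 2 ≤ (∫ p in D, ‖fderiv ℝ φ p (EuclideanSpace.single 0 1)‖ ^ 2) +
        ∫ p in D, ‖fderiv ℝ φ p (EuclideanSpace.single 1 1)‖ ^ 2)
    {w : L2 D × (Fin 2 → L2 D)} (hw : w ∈ formDomainGraph D U) :
    (1 + δ) * ‖w.1‖ ^ 2 ≤ ∑ i, ‖w.2 i‖ ^ 2 := by
  refine formDomainGraph_induction (p := fun w => (1 + δ) * ‖w.1‖ ^ 2 ≤ ∑ i, ‖w.2 i‖ ^ 2)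
    (isClosed_le (by fun_prop) (by fun_prop)) (by simp) ?_ hw
  rintro w ⟨φ, h1, h2, h3, h4, h5⟩
  have e : ∀ {f : L2 D} {ψ : Plane → ℂ}, f =ᵐ[volume.restrict D] ψ →
      ‖f‖ ^ 2 = ∫ p in D, ‖ψ p‖ ^ 2 := fun {f ψ} hf => by
    rw [norm_sq_eq_integral]
    refine integral_congr_ae ?_
    filter_upwards [hf] with x hx
    rw [hx]
  rw [Fin.sum_univ_two, e h4, e (h5 0), e (h5 1)]
  exact h φ h1 h2 h3

/-! ### The resolvent below a form bound -/

/-- Riesz representation for the form `⟪z, w⟫ - b ⟪π z, π w⟫` on a Hilbert space `K`. -/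
theorem exists_riesz_operator {K H : Type*} [NormedAddCommGroup K] [InnerProductSpace ℂ K]
    [CompleteSpace K] [NormedAddCommGroup H] [InnerProductSpace ℂ H] [CompleteSpace H]
    (π : K →L[ℂ] H) {b c : ℝ} (hc : 0 < c)
    (h : ∀ w, c * ‖w‖ ^ 2 ≤ ‖w‖ ^ 2 - b * ‖π w‖ ^ 2) :
    ∃ Q : H →L[ℂ] K, ∀ (F : H) (z : K),
      inner ℂ z (Q F) - (b : ℂ) * inner ℂ (π z) (π (Q F)) = inner ℂ (π z) F := by
  let A : K →L[ℂ] K := 1 - (b : ℂ) • (ContinuousLinearMap.adjoint π ∘L π)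
  have hA : ∀ z w : K, inner ℂ z (A w) = inner ℂ z w - (b : ℂ) * inner ℂ (π z) (π w) := by
    intro z w
    rw [← ContinuousLinearMap.adjoint_inner_right, ← inner_smul_right, ← inner_sub_right]
    rfl
  have hunit : IsUnit A := by
    refine ContinuousLinearMap.isUnit_of_forall_le_norm_inner_map A (c := ⟨c, hc.le⟩) hc
      fun w => ?_
    have h1 : inner ℂ w (A w) = ((‖w‖ ^ 2 - b * ‖π w‖ ^ 2 : ℝ) : ℂ) := by
      rw [hA, inner_self_eq_norm_sq_to_K, inner_self_eq_norm_sq_to_K]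
      push_cast
      rfl
    rw [norm_inner_symm, h1, Complex.norm_real, mul_comm]
    exact (h w).trans (le_abs_self _)
  obtain ⟨B, hB⟩ := hunit.exists_right_inv
  refine ⟨B ∘L ContinuousLinearMap.adjoint π, fun F z => ?_⟩
  have hAw : A (B (ContinuousLinearMap.adjoint π F)) = ContinuousLinearMap.adjoint π F :=
    DFunLike.congr_fun hB _
  rw [← hA, ContinuousLinearMap.comp_apply, hAw, ContinuousLinearMap.adjoint_inner_right]

/-- The solution operator of a closed form above its spectral parameter: `V` consists of pairs
`(u, ∇u)`, and `u = R F` is the weak solution of `-Δu - E u = F`.  The graph norm turns `V` into a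
Hilbert space. -/
theorem exists_solution_operator {H : Type*} [NormedAddCommGroup H] [InnerProductSpace ℂ H]
    [CompleteSpace H] (V : Submodule ℂ (H × (Fin 2 → H)))
    (hV : IsClosed (V : Set (H × (Fin 2 → H)))) {δ E : ℝ}
    (hδ : ∀ w ∈ V, (1 + δ) * ‖w.1‖ ^ 2 ≤ ∑ i, ‖w.2 i‖ ^ 2) (hE0 : 0 ≤ E) (hE : E < 1 + δ) :
    ∃ R : H →L[ℂ] H, ∀ F : H, ∃ p : Fin 2 → H, (R F, p) ∈ V ∧
      ∀ z ∈ V, ∑ i, inner ℂ (z.2 i) (p i) = inner ℂ z.1 (F + (E : ℂ) • R F) := by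
  let j : PiLp 2 (fun _ : Fin 3 => H) →L[ℂ] H × (Fin 2 → H) :=
    (PiLp.proj (𝕜 := ℂ) 2 (fun _ : Fin 3 => H) 0).prod
      (ContinuousLinearMap.pi fun i : Fin 2 => PiLp.proj (𝕜 := ℂ) 2 (fun _ : Fin 3 => H) i.succ)
  have hj1 : ∀ w, (j w).1 = w 0 := fun w => rfl
  have hj2 : ∀ w i, (j w).2 i = w (Fin.succ i) := fun w i => rfl
  let K : Submodule ℂ (PiLp 2 (fun _ : Fin 3 => H)) := V.comap j.toLinearMap
  have hKV : ∀ w : K, j w ∈ V := fun w => w.2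
  have hK : IsClosed (K : Set (PiLp 2 (fun _ : Fin 3 => H))) := hV.preimage j.continuous
  have : CompleteSpace K := hK.completeSpace_coe
  let π : K →L[ℂ] H := (PiLp.proj (𝕜 := ℂ) 2 (fun _ : Fin 3 => H) 0).comp K.subtypeL
  have hπ : ∀ w : K, π w = (j w).1 := fun w => rfl
  have hinner : ∀ z w : K, inner ℂ z w =
      inner ℂ (j z).1 (j w).1 + ∑ i : Fin 2, inner ℂ ((j z).2 i) ((j w).2 i) := by
    intro z w
    rw [Submodule.coe_inner, PiLp.inner_apply, Fin.sum_univ_succ]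
    rfl
  have hnorm : ∀ w : K, ‖w‖ ^ 2 = ‖(j w).1‖ ^ 2 + ∑ i : Fin 2, ‖(j w).2 i‖ ^ 2 := by
    intro w
    rw [Submodule.coe_norm, PiLp.norm_sq_eq_of_L2, Fin.sum_univ_succ]
    rfl
  set c : ℝ := (δ + 1 - E) / (2 + δ) with hc
  have h2δ : 0 < 2 + δ := by linarith
  have hc0 : 0 < c := div_pos (by linarith) h2δ
  have hc1 : c ≤ 1 := (div_le_one h2δ).2 (by linarith)
  have hcδ : c * (2 + δ) = δ + 1 - E := div_mul_cancel₀ _ h2δ.ne'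
  obtain ⟨Q, hQ⟩ := exists_riesz_operator π (b := 1 + E) hc0 fun w => by
    have h2 := hδ _ (hKV w)
    rw [hnorm, hπ]
    nlinarith [mul_le_mul_of_nonneg_left h2 (sub_nonneg.2 hc1)]
  refine ⟨π ∘L Q, fun F => ⟨(j (Q F)).2, hKV (Q F), fun z hz => ?_⟩⟩
  have hjz : j (WithLp.toLp 2 (Fin.cons z.1 z.2)) = z := rfl
  have h1 := hQ F ⟨WithLp.toLp 2 (Fin.cons z.1 z.2), show j _ ∈ V from hjz ▸ hz⟩
  rw [hinner, hπ, hπ, hjz] at h1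
  rw [ContinuousLinearMap.comp_apply, hπ, inner_add_right, inner_smul_right, ← h1]
  push_cast
  ring

section Resolvent

variable {D U : Set Plane} {δ E : ℝ}

/-- There is no eigenvalue below the form bound. -/
theorem eq_zero_of_mem_laplacianGraph
    (hδ : ∀ w ∈ formDomainGraph D U, (1 + δ) * ‖w.1‖ ^ 2 ≤ ∑ i, ‖w.2 i‖ ^ 2) (hE : E < 1 + δ)
    {u : L2 D} (hu : (u, (E : ℂ) • u) ∈ laplacianGraph D U) : u = 0 := by
  obtain ⟨p, hp, h⟩ := hu
  have h1 := h (u, p) hp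
  have h2 := hδ (u, p) hp
  simp only [inner_self_eq_norm_sq_to_K, inner_smul_right] at h1
  have h3 : ∑ i, ‖p i‖ ^ 2 = E * ‖u‖ ^ 2 := by
    apply Complex.ofReal_injective
    push_cast
    exact h1
  simp only at h2
  rw [h3] at h2
  have h4 : ‖u‖ ^ 2 ≤ 0 := by nlinarith [sq_nonneg ‖u‖]
  exact norm_eq_zero.1 (pow_eq_zero_iff two_ne_zero |>.1 (le_antisymm h4 (sq_nonneg _)))

theorem exists_isResolvent (hD : IsOpen D) (hDU : D ⊆ U)
    (hδ : ∀ w ∈ formDomainGraph D U, (1 + δ) * ‖w.1‖ ^ 2 ≤ ∑ i, ‖w.2 i‖ ^ 2)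
    (hE0 : 0 ≤ E) (hE : E < 1 + δ) :
    ∃ R : L2 D →L[ℂ] L2 D, IsResolvent (mixedLaplacian D U) (E : ℂ) R ∧
      ∀ F, (R F, F + (E : ℂ) • R F) ∈ laplacianGraph D U := by
  obtain ⟨R, hR⟩ := exists_solution_operator (formDomainGraph D U)
    (Submodule.isClosed_topologicalClosure _) hδ hE0 hE
  have hR' : ∀ F, (R F, F + (E : ℂ) • R F) ∈ laplacianGraph D U := hR
  refine ⟨R, ⟨fun F => ?_, fun u => ?_⟩, hR'⟩
  · have h1 := hR' F
    rw [← mixedLaplacian_graph hD hDU, LinearPMap.mem_graph_iff] at h1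
    obtain ⟨y, hy1, hy2⟩ := h1
    simp only at hy1 hy2
    have hdom : R F ∈ (mixedLaplacian D U).domain := hy1 ▸ y.2
    refine ⟨hdom, ?_⟩
    have : y = ⟨R F, hdom⟩ := Subtype.ext hy1
    rw [← this, hy2, add_sub_cancel_right]
  · set F := (mixedLaplacian D U) u - (E : ℂ) • (u : L2 D) with hF
    have h1 : ((u : L2 D), (mixedLaplacian D U) u) ∈ laplacianGraph D U := by
      rw [← mixedLaplacian_graph hD hDU]
      exact LinearPMap.mem_graph _ u
    have h2 := (laplacianGraph D U).sub_mem (hR' F) h1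
    rw [← sub_eq_zero]
    refine eq_zero_of_mem_laplacianGraph hδ hE ?_
    convert h2 using 1
    rw [Prod.mk_sub_mk, hF, smul_sub]
    congr 1
    abel

/-! ### Exponential decay of the resolvent -/

theorem exists_multiplier {m : Plane → ℝ} (hm : Measurable m) {C : ℝ}
    (hC : ∀ᵐ x ∂volume.restrict D, |m x| ≤ C) :
    ∃ T : L2 D →L[ℂ] L2 D, ∀ f : L2 D, T f =ᵐ[volume.restrict D] fun x => (m x : ℂ) * f x := by
  have hM : MemLp (fun x => (m x : ℂ)) ∞ (volume.restrict D) :=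
    memLp_top_of_bound (Complex.measurable_ofReal.comp hm).aestronglyMeasurable C (by
      filter_upwards [hC] with x hx
      simpa using hx)
  refine ⟨(ContinuousLinearMap.mul ℂ ℂ).holderL (volume.restrict D) ∞ 2 2 (hM.toLp _), fun f => ?_⟩
  have h1 := (ContinuousLinearMap.mul ℂ ℂ).coeFn_holder (r := 2) (hM.toLp _) f
  filter_upwards [h1, hM.coeFn_toLp] with x hx hx'
  refine hx.trans ?_
  rw [hx']
  rfl

theorem inner_multiplier {m : Plane → ℝ} {T : L2 D →L[ℂ] L2 D}
    (hT : ∀ f : L2 D, T f =ᵐ[volume.restrict D] fun x => (m x : ℂ) * f x) (f h : L2 D) :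
    inner ℂ (T f) h = inner ℂ f (T h) := by
  rw [L2.inner_def, L2.inner_def]
  refine integral_congr_ae ?_
  filter_upwards [hT f, hT h] with x h1 h2
  rw [h1, h2]
  simp only [RCLike.inner_apply, map_mul, Complex.conj_ofReal]
  ring

/-- Multiplication by `e^{a (s - x₁)}` preserves the form domain, and acts on gradients by the product
rule. -/
theorem multiplier_mem_formDomainGraph {a s : ℝ} {T : L2 D →L[ℂ] L2 D}
    (hT : ∀ f : L2 D, T f =ᵐ[volume.restrict D]
      fun x => (Real.exp (a * (s - x 0)) : ℂ) * f x)
    {w : L2 D × (Fin 2 → L2 D)} (hw : w ∈ formDomainGraph D U) :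
    (T w.1, ![T (w.2 0) - (a : ℂ) • T w.1, T (w.2 1)]) ∈ formDomainGraph D U := by
  refine formDomainGraph_induction
    (p := fun w => (T w.1, ![T (w.2 0) - (a : ℂ) • T w.1, T (w.2 1)]) ∈ formDomainGraph D U)
    ?_ ?_ ?_ hw
  · refine (Submodule.isClosed_topologicalClosure _).preimage (Continuous.prodMk (by fun_prop) ?_)
    refine continuous_pi fun i => ?_
    fin_cases i
    · simp only [Fin.zero_eta, Matrix.cons_val_zero]; fun_prop
    · simp only [Fin.mk_one, Matrix.cons_val_one, Matrix.cons_val_zero]; fun_prop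
  · convert (formDomainGraph D U).zero_mem using 1
    ext1
    · simp
    · ext1 i
      fin_cases i <;> simp
  · rintro w ⟨φ, h1, h2, h3, h4, h5⟩
    refine Submodule.le_topologicalClosure _ (Submodule.subset_span ?_)
    set M : Plane → ℂ := fun x => ((Real.exp (a * (s - x 0)) : ℝ) : ℂ) with hM
    have hMr : ContDiff ℝ (⊤ : ℕ∞) fun x : Plane => Real.exp (a * (s - x 0)) := by fun_prop
    have hMc : ContDiff ℝ (⊤ : ℕ∞) M := Complex.ofRealCLM.contDiff.comp hMr
    have hproj : ∀ x : Plane, HasFDerivAt (fun x : Plane => x 0)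
        (EuclideanSpace.proj (𝕜 := ℝ) (0 : Fin 2)) x := fun x =>
      (EuclideanSpace.proj (𝕜 := ℝ) (0 : Fin 2) : Plane →L[ℝ] ℝ).hasFDerivAt
    have hMd : ∀ x e : Plane, fderiv ℝ M x e = -(a : ℂ) * M x * (e 0 : ℂ) := fun x e => by
      have := Complex.ofRealCLM.hasFDerivAt.comp x
        ((((hproj x).const_sub s).const_mul a).exp)
      have := DFunLike.congr_fun (show fderiv ℝ M x = _ from this.fderiv) e
      rw [this]
      simp [hM]
      ring
    have hd : ∀ x e : Plane, fderiv ℝ (fun x => M x * φ x) x e =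
        M x * fderiv ℝ φ x e - (a : ℂ) * (M x * φ x) * (e 0 : ℂ) := fun x e => by
      rw [fderiv_fun_mul (hMc.differentiable (by simp) x) (h1.differentiable (by simp) x)]
      simp only [add_apply, smul_apply, smul_eq_mul, hMd]
      ring
    refine ⟨fun x => M x * φ x, hMc.mul h1, h2.mul_left, ?_, ?_, fun i => ?_⟩
    · exact (tsupport_mul_subset_right (f := M) (g := φ)).trans h3
    · filter_upwards [hT w.1, h4] with x hx hx'
      rw [hx, hx', hM]
    · fin_cases i
      · filter_upwards [Lp.coeFn_sub (T (w.2 0)) ((a : ℂ) • T w.1),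
          Lp.coeFn_smul (a : ℂ) (T w.1), hT w.1, h4, hT (w.2 0), h5 0] with x e1 e2 e3 e4 e5 e6
        simp only [Fin.zero_eta, Matrix.cons_val_zero]
        rw [e1, Pi.sub_apply, e2, Pi.smul_apply, e3, e4, e5, e6, hd]
        simp [hM]
      · filter_upwards [hT (w.2 1), h5 1] with x e5 e6
        simp only [Fin.mk_one, Matrix.cons_val_one, Matrix.cons_val_zero]
        rw [e5, e6, hd]
        simp [hM]

/-- The weighted energy estimate behind the decay of the resolvent: the weight `e^{a (s - x₁)}` shifts
the form bound by at most `a²`. -/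
theorem weighted_estimate {a s : ℝ} {T : L2 D →L[ℂ] L2 D}
    (hT : ∀ f : L2 D, T f =ᵐ[volume.restrict D]
      fun x => (Real.exp (a * (s - x 0)) : ℂ) * f x)
    (hδ : ∀ w ∈ formDomainGraph D U, (1 + δ) * ‖w.1‖ ^ 2 ≤ ∑ i, ‖w.2 i‖ ^ 2)
    {u F : L2 D} (hu : (u, F + (E : ℂ) • u) ∈ laplacianGraph D U) :
    (δ + 1 - E - a ^ 2) * ‖T u‖ ≤ ‖T F‖ := by
  obtain ⟨p, hp, h⟩ := hu
  simp only at hp h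
  have hTT : ∀ f : L2 D, (T ∘L T) f =ᵐ[volume.restrict D]
      fun x => (Real.exp (2 * a * (s - x 0)) : ℂ) * f x := fun f => by
    filter_upwards [hT (T f), hT f] with x h1 h2
    rw [ContinuousLinearMap.comp_apply, h1, h2, ← mul_assoc, ← Complex.ofReal_mul, ← Real.exp_add]
    congr 3
    ring
  have hsymm := inner_multiplier (m := fun x => Real.exp (a * (s - x 0))) hT
  have h1 := h _ (multiplier_mem_formDomainGraph hTT hp)
  have h2 := hδ _ (multiplier_mem_formDomainGraph hT hp)
  simp only [Fin.sum_univ_two, Matrix.cons_val_zero, Matrix.cons_val_one, inner_sub_left,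
    inner_smul_left, ContinuousLinearMap.comp_apply, hsymm, inner_add_right, inner_smul_right,
    map_add, map_smul] at h1
  simp only [Fin.sum_univ_two, Matrix.cons_val_zero, Matrix.cons_val_one] at h2
  have hs2 : ∀ f g : L2 D, inner ℂ f (T (T g)) = inner ℂ (T f) (T g) := fun f g =>
    (hsymm f (T g)).symm
  have hself : ∀ f : L2 D, inner ℂ f f = ((‖f‖ ^ 2 : ℝ) : ℂ) := fun f => by
    rw [inner_self_eq_norm_sq_to_K]; norm_cast
  simp only [hs2] at h1
  rw [hself, hself, hself, Complex.conj_ofReal] at h1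
  have h1re := congrArg Complex.re h1
  simp only [Complex.add_re, Complex.sub_re, Complex.re_ofReal_mul, Complex.ofReal_re] at h1re
  have h3 : ‖T (p 0) - (a : ℂ) • T u‖ ^ 2 =
      ‖T (p 0)‖ ^ 2 - 2 * (a * (inner ℂ (T u) (T (p 0)) : ℂ).re) + a ^ 2 * ‖T u‖ ^ 2 := by
    rw [norm_sub_sq (𝕜 := ℂ), inner_smul_right, norm_smul, mul_pow, Complex.norm_real,
      Real.norm_eq_abs, sq_abs]
    simp only [RCLike.re_to_complex, Complex.re_ofReal_mul]
    rw [show (inner ℂ (T (p 0)) (T u) : ℂ).re = (inner ℂ (T u) (T (p 0)) : ℂ).re from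
      inner_re_symm (𝕜 := ℂ) _ _]
  have h4 : (inner ℂ (T u) (T F) : ℂ).re ≤ ‖T u‖ * ‖T F‖ :=
    (Complex.re_le_norm _).trans (norm_inner_le_norm _ _)
  have h5 : ((δ + 1 - E - a ^ 2) * ‖T u‖) * ‖T u‖ ≤ ‖T F‖ * ‖T u‖ := by
    rw [h3] at h2
    nlinarith
  rcases (norm_nonneg (T u)).eq_or_lt with h0 | h0
  · rw [← h0, mul_zero]
    exact norm_nonneg _
  · exact le_of_mul_le_mul_right h5 h0

/-- The resolvent kernel between two sets decays exponentially in their separation along the axis of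
the guide. -/
theorem norm_chi_resolvent_chi_le {a s t : ℝ} (hD : MeasurableSet D)
    (hD0 : ∀ x ∈ D, 0 < x 0) (ha : 0 ≤ a)
    (hδ : ∀ w ∈ formDomainGraph D U, (1 + δ) * ‖w.1‖ ^ 2 ≤ ∑ i, ‖w.2 i‖ ^ 2)
    (hE : 0 < δ + 1 - E - a ^ 2) {A B : Set Plane} (hA : MeasurableSet A) (hB : MeasurableSet B)
    (hAt : ∀ x ∈ A, t ≤ a * (s - x 0)) (hBs : ∀ x ∈ B, s ≤ x 0)
    {R : L2 D →L[ℂ] L2 D} (hR : ∀ F, (R F, F + (E : ℂ) • R F) ∈ laplacianGraph D U) :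
    ‖chi D A ∘L R ∘L chi D B‖ ≤ (δ + 1 - E - a ^ 2)⁻¹ * Real.exp (-t) := by
  have hDae : ∀ᵐ x ∂volume.restrict D, x ∈ D := ae_restrict_mem hD
  obtain ⟨T, hT⟩ := exists_multiplier (D := D) (m := fun x => Real.exp (a * (s - x 0)))
    (by fun_prop) (C := Real.exp (a * s)) (by
      filter_upwards [hDae] with x hx
      rw [abs_of_pos (Real.exp_pos _)]
      exact Real.exp_le_exp.2 (mul_le_mul_of_nonneg_left (by linarith [hD0 x hx]) ha))
  refine ContinuousLinearMap.opNorm_le_bound _ (by positivity) fun f => ?_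
  simp only [ContinuousLinearMap.comp_apply]
  set F := chi D B f with hF
  have h1 := weighted_estimate hT hδ (hR F)
  have h2 : ‖T F‖ ≤ ‖f‖ := by
    refine Lp.norm_le_norm_of_ae_le ?_
    filter_upwards [hT F, chi_apply hB f] with x e1 e2
    rw [e1, hF, e2]
    by_cases hx : x ∈ B
    · rw [indicator_of_mem hx, norm_mul, Complex.norm_real, Real.norm_eq_abs,
        abs_of_pos (Real.exp_pos _)]
      refine mul_le_of_le_one_left (norm_nonneg _) (Real.exp_le_one_iff.2 ?_)
      exact mul_nonpos_of_nonneg_of_nonpos ha (by linarith [hBs x hx])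
    · rw [indicator_of_notMem hx, mul_zero, norm_zero]
      exact norm_nonneg _
  have h3 : ‖chi D A (R F)‖ ≤ Real.exp (-t) * ‖T (R F)‖ := by
    refine Lp.norm_le_mul_norm_of_ae_le_mul ?_
    filter_upwards [hT (R F), chi_apply hA (R F)] with x e1 e2
    rw [e1, e2]
    by_cases hx : x ∈ A
    · rw [indicator_of_mem hx, norm_mul, Complex.norm_real, Real.norm_eq_abs,
        abs_of_pos (Real.exp_pos _), ← mul_assoc, ← Real.exp_add]
      refine le_mul_of_one_le_left (norm_nonneg _) (Real.one_le_exp ?_)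
      linarith [hAt x hx]
    · rw [indicator_of_notMem hx, norm_zero]
      positivity
  calc ‖chi D A (R F)‖ ≤ Real.exp (-t) * ‖T (R F)‖ := h3
    _ ≤ Real.exp (-t) * ((δ + 1 - E - a ^ 2)⁻¹ * ‖f‖) := by
      gcongr
      rw [inv_mul_eq_div, le_div_iff₀ hE, mul_comm]
      exact h1.trans h2
    _ = _ := by ring

end Resolvent

/-! ### The bump function and the profile -/

section Bump

variable {l : ℝ} {g : ℝ → ℝ}

theorem abs_le_supNorm {f : ℝ → ℝ} (hf : Continuous f) (hs : Function.support f ⊆ Ioo 0 l) (t : ℝ)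
    (h1 : supNorm l f ≤ 1) : |f t| ≤ 1 := by
  by_cases ht : t ∈ Ioo 0 l
  · refine le_trans ?_ h1
    exact le_csSup ((isCompact_Icc.image hf.abs).bddAbove)
      (mem_image_of_mem _ (Ioo_subset_Icc_self ht))
  · rw [Function.notMem_support.1 fun h => ht (hs h), abs_zero]
    exact zero_le_one

theorem IsBump.support_subset (hg : IsBump l g) : Function.support g ⊆ Ioo 0 l :=
  (subset_tsupport g).trans hg.tsupport_subset

theorem IsBump.support_deriv_subset (hg : IsBump l g) : Function.support (deriv g) ⊆ Ioo 0 l :=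
  (_root_.support_deriv_subset).trans hg.tsupport_subset

theorem IsBump.support_deriv_deriv_subset (hg : IsBump l g) :
    Function.support (deriv (deriv g)) ⊆ Ioo 0 l :=
  (_root_.support_deriv_subset).trans
    ((closure_minimal _root_.support_deriv_subset (isClosed_tsupport g)).trans hg.tsupport_subset)

theorem IsBump.continuous (hg : IsBump l g) : Continuous g := hg.contDiff.continuous

theorem IsBump.contDiff_deriv (hg : IsBump l g) : ContDiff ℝ 1 (deriv g) :=
  ((contDiff_succ_iff_deriv (n := 1)).1 hg.contDiff).2.2

theorem IsBump.continuous_deriv (hg : IsBump l g) : Continuous (deriv g) :=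
  hg.contDiff_deriv.continuous

theorem IsBump.continuous_deriv_deriv (hg : IsBump l g) : Continuous (deriv (deriv g)) :=
  hg.contDiff_deriv.continuous_deriv le_rfl

theorem IsBump.hasDerivAt (hg : IsBump l g) (t : ℝ) : HasDerivAt g (deriv g t) t :=
  (hg.contDiff.differentiable (by simp) t).hasDerivAt

theorem IsBump.hasDerivAt_deriv (hg : IsBump l g) (t : ℝ) :
    HasDerivAt (deriv g) (deriv (deriv g) t) t :=
  (hg.contDiff_deriv.differentiable (by simp) t).hasDerivAt

theorem IsBump.abs_le (hg : IsBump l g) (t : ℝ) : |g t| ≤ 1 :=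
  abs_le_supNorm hg.continuous hg.support_subset t (hg.normalized ▸ le_max_left _ _)

theorem IsBump.abs_deriv_le (hg : IsBump l g) (t : ℝ) : |deriv g t| ≤ 1 :=
  abs_le_supNorm hg.continuous_deriv hg.support_deriv_subset t
    (hg.normalized ▸ (le_max_left _ _).trans (le_max_right _ _))

theorem IsBump.abs_deriv_deriv_le (hg : IsBump l g) (t : ℝ) : |deriv (deriv g) t| ≤ 1 :=
  abs_le_supNorm hg.continuous_deriv_deriv hg.support_deriv_deriv_subset t
    (hg.normalized ▸ (le_max_right _ _).trans (le_max_right _ _))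

theorem IsBump.exists_ne_zero (hg : IsBump l g) : ∃ t ∈ Ioo 0 l, g t ≠ 0 := by
  by_contra! h
  have h0 : g = 0 := by
    ext t
    by_contra hne
    exact hne (h t (hg.support_subset hne))
  have hz : supNorm l (0 : ℝ → ℝ) ≤ 0 :=
    Real.sSup_nonpos (by rintro _ ⟨t, -, rfl⟩; simp)
  have h1 := hg.normalized
  have hd : deriv (0 : ℝ → ℝ) = 0 := by ext t; simp
  rw [h0, hd, hd, max_self, max_self] at h1
  linarith

theorem IsBump.exists_deriv_ne_zero (hg : IsBump l g) : ∃ t ∈ Ioo 0 l, deriv g t ≠ 0 := by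
  by_contra! h
  have h0 : ∀ t, deriv g t = 0 := fun t => by
    by_contra hne
    exact hne (h t (hg.support_deriv_subset hne))
  obtain ⟨t, -, ht⟩ := hg.exists_ne_zero
  apply ht
  rw [is_const_of_deriv_eq_zero (hg.contDiff.differentiable (by simp)) h0 t 0]
  by_contra hne
  exact lt_irrefl _ (hg.support_subset hne).1

theorem IsBump.integral_deriv_sq_pos (hl : 0 < l) (hg : IsBump l g) :
    0 < ∫ t in (0 : ℝ)..l, deriv g t ^ 2 := by
  obtain ⟨t, ht, hne⟩ := hg.exists_deriv_ne_zero
  have := hg.continuous_deriv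
  exact intervalIntegral.integral_pos hl (by fun_prop) (fun x _ => sq_nonneg _)
    ⟨t, Ioo_subset_Icc_self ht, by positivity⟩

theorem IsBump.gTildeNormSq_pos (hl : 0 < l) (hg : IsBump l g) : 0 < gTildeNormSq l g := by
  have := hg.continuous
  unfold gTildeNormSq
  set c := (1 / l) * ∫ s in (0 : ℝ)..l, g s
  refine intervalIntegral.integral_pos hl (by fun_prop) (fun x _ => sq_nonneg _) ?_
  obtain ⟨t, ht, hne⟩ := hg.exists_ne_zero
  by_cases hc : c = 0
  · exact ⟨t, Ioo_subset_Icc_self ht, by rw [hc, sub_zero]; positivity⟩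
  · have h0 : g 0 = 0 := by
      by_contra hne
      exact lt_irrefl _ (hg.support_subset hne).1
    exact ⟨0, ⟨le_rfl, hl.le⟩, by rw [h0, zero_sub, neg_sq]; positivity⟩

theorem profile_eq_of_mem_Ioo (hl : 0 < l) (hs : Function.support g ⊆ Ioo 0 l) (ω : ℤ → ℝ≥0) {k : ℤ}
    {t : ℝ} (ht : t ∈ Ioo ((k - 1) * l) ((k + 1) * l)) :
    profile l g ω t = ω (k - 1) * g (t - (k - 1) * l) + ω k * g (t - k * l) := by
  unfold profile
  rw [tsum_eq_sum (s := {k - 1, k}), Finset.sum_pair (by simp)]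
  · push_cast; rfl
  · intro j hj
    by_contra hne
    have h1 := hs (right_ne_zero_of_mul hne)
    have h2 : (j : ℝ) < k + 1 := lt_of_mul_lt_mul_right (by linarith [h1.1, ht.2]) hl.le
    have h3 : (k : ℝ) - 1 < j + 1 := lt_of_mul_lt_mul_right (by linarith [h1.2, ht.1]) hl.le
    have h2' : j < k + 1 := by exact_mod_cast h2
    have h3' : k - 1 < j + 1 := by exact_mod_cast h3
    simp only [Finset.mem_insert, Finset.mem_singleton, not_or] at hj
    omega

theorem profile_eq_of_mem_Icc (hl : 0 < l) (hs : Function.support g ⊆ Ioo 0 l) (ω : ℤ → ℝ≥0) {k : ℤ}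
    {t : ℝ} (ht : t ∈ Icc (k * l) ((k + 1) * l)) : profile l g ω t = ω k * g (t - k * l) := by
  unfold profile
  refine tsum_eq_single k fun j hj => ?_
  by_contra hne
  have h1 := hs (right_ne_zero_of_mul hne)
  have h2 : (j : ℝ) < k + 1 := lt_of_mul_lt_mul_right (by linarith [h1.1, ht.2]) hl.le
  have h3 : (k : ℝ) < j + 1 := lt_of_mul_lt_mul_right (by linarith [h1.2, ht.1]) hl.le
  have h2' : j < k + 1 := by exact_mod_cast h2
  have h3' : k < j + 1 := by exact_mod_cast h3
  omega

theorem mem_cell (hl : 0 < l) (t : ℝ) :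
    t ∈ Ico ((⌊t / l⌋ : ℝ) * l) ((⌊t / l⌋ + 1) * l) :=
  ⟨(le_div_iff₀ hl).1 (Int.floor_le _), (div_lt_iff₀ hl).1 (Int.lt_floor_add_one _)⟩

theorem hasDerivAt_profile {g' : ℝ → ℝ} (hl : 0 < l) (hs : Function.support g ⊆ Ioo 0 l)
    (hs' : Function.support g' ⊆ Ioo 0 l) (hg : ∀ t, HasDerivAt g (g' t) t) (ω : ℤ → ℝ≥0) (t : ℝ) :
    HasDerivAt (profile l g ω) (profile l g' ω t) t := by
  have h := mem_cell hl t
  set k := ⌊t / l⌋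
  have ht : t ∈ Ioo (((k : ℝ) - 1) * l) ((k + 1) * l) := ⟨by linarith [h.1], h.2⟩
  rw [profile_eq_of_mem_Ioo hl hs' ω ht]
  refine HasDerivAt.congr_of_eventuallyEq (f := fun t =>
    (ω (k - 1) : ℝ) * g (t - (k - 1) * l) + ω k * g (t - k * l)) ?_ ?_
  · exact (((hg _).comp_sub_const t _).const_mul _).add (((hg _).comp_sub_const t _).const_mul _)
  · filter_upwards [Ioo_mem_nhds ht.1 ht.2] with s hs1
    exact profile_eq_of_mem_Ioo hl hs ω hs1

theorem abs_profile_le (hl : 0 < l) (hs : Function.support g ⊆ Ioo 0 l) (hg : ∀ t, |g t| ≤ 1)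
    {ω : ℤ → ℝ≥0} (hω : ∀ k, ω k ≤ 1) (t : ℝ) : |profile l g ω t| ≤ 1 := by
  have h := mem_cell hl t
  rw [profile_eq_of_mem_Icc hl hs ω (Ico_subset_Icc_self h), abs_mul, NNReal.abs_eq]
  exact mul_le_one₀ (by exact_mod_cast hω _) (abs_nonneg _) (hg _)

theorem profile_mul_eq_zero (hl : 0 < l) (hs : Function.support g ⊆ Ioo 0 l) (ω : ℤ → ℝ≥0) (k : ℕ) :
    profile l g ω (k * l) = 0 := by
  rw [profile_eq_of_mem_Icc hl hs ω (k := k) ⟨by simp, by push_cast; linarith⟩]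
  have : g 0 = 0 := by
    by_contra hne
    exact lt_irrefl _ (hs hne).1
  simp [this]

theorem integral_profile_sq (hl : 0 < l) (hg : Continuous g) (hs : Function.support g ⊆ Ioo 0 l)
    (κ : ℝ) (ω : ℤ → ℝ≥0) {a b : ℕ} (hab : a ≤ b) :
    ∫ x in (a : ℝ) * l..b * l, (κ * profile l g ω x) ^ 2 =
      κ ^ 2 * (∑ k ∈ Finset.Ico a b, (ω k : ℝ) ^ 2) * ∫ t in (0 : ℝ)..l, g t ^ 2 := by
  have hc := continuous_profile hl hg hs ω
  rw [← intervalIntegral.sum_integral_adjacent_intervals_Ico (a := fun k : ℕ => (k : ℝ) * l) hab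
    fun k _ => Continuous.intervalIntegrable (by fun_prop) _ _, Finset.mul_sum, Finset.sum_mul]
  refine Finset.sum_congr rfl fun k _ => ?_
  have h1 : ∫ x in (k : ℝ) * l..((k + 1 : ℕ) : ℝ) * l, (κ * profile l g ω x) ^ 2 =
      ∫ x in (k : ℝ) * l..((k + 1 : ℕ) : ℝ) * l,
        (fun x => κ ^ 2 * (ω k : ℝ) ^ 2 * g x ^ 2) (x - k * l) := by
    refine intervalIntegral.integral_congr fun x hx => ?_
    rw [uIcc_of_le (by push_cast; linarith)] at hx
    simp only
    rw [profile_eq_of_mem_Icc hl hs ω (k := (k : ℤ)) (by simpa using hx)]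
    simp only [Int.cast_natCast]
    ring
  rw [h1, intervalIntegral.integral_comp_sub_right
    (fun x => κ ^ 2 * (ω k : ℝ) ^ 2 * g x ^ 2) ((k : ℝ) * l), intervalIntegral.integral_const_mul]
  congr 2
  · ring
  · push_cast; ring

end Bump

/-! ### The form bound for the waveguide -/

/-- The left end, in units of `l`, of block number `j` when `N` cells are cut into `m = N / n` blocks of
`n` cells each, the last of which takes up the remainder. -/
def cut (n N j : ℕ) : ℕ := if j < N / n then j * n else N

theorem cut_zero {n N : ℕ} (hn : 0 < n) (hnN : n ≤ N) : cut n N 0 = 0 := by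
  simp [cut, Nat.div_pos hnN hn]

theorem cut_last (n N : ℕ) : cut n N (N / n) = N := by simp [cut]

theorem cut_succ_bounds {n N j : ℕ} (hn : 0 < n) (hj : j < N / n) :
    cut n N j + n ≤ cut n N (j + 1) ∧ cut n N (j + 1) ≤ cut n N j + 2 * n := by
  have h1 := Nat.div_add_mod N n
  have h2 := Nat.mod_lt N hn
  simp only [cut, hj, if_true]
  split_ifs with h
  · constructor <;> nlinarith
  · have h3 : N / n = j + 1 := by omega
    rw [h3] at h1
    have h4 := Nat.zero_le (N % n)
    constructor <;> nlinarith

/-- The good configurations: the shifts are at most `1`, and their mean over every block is at least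
half of the expectation `e`. -/
def goodSet (e : ℝ) (n N : ℕ) : Set (ℤ → ℝ≥0) :=
  {ω | (∀ k, ω k ≤ 1) ∧ ∀ j < N / n, ((cut n N (j + 1) : ℝ) - cut n N j) * (e / 2) ≤
    ∑ k ∈ Finset.Ico (cut n N j) (cut n N (j + 1)), (ω k : ℝ)}

/-- On good configurations the Laplacian of the segment is bounded below by `1 + δ`. -/
theorem form_bound_guide {l e κ δ : ℝ} {g : ℝ → ℝ} {n N : ℕ} {ω : ℤ → ℝ≥0} (hl : 0 < l)
    (hg : IsBump l g) (he : 0 < e) (hκ0 : 0 < κ) (hκ : κ ≤ 1) (hn : 0 < n) (hnN : n ≤ N)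
    (hω : ω ∈ goodSet e n N) (hδ0 : 0 ≤ δ)
    (hδ : δ * (672 * (16 * l ^ 2 / (κ ^ 2 * e ^ 4 * (∫ t in (0 : ℝ)..l, deriv g t ^ 2) ^ 2) +
      (2 * n * l) ^ 2) + 60) ≤ 1) :
    ∀ w ∈ formDomainGraph (guideSegment l g κ ω N) (guide l g κ ω),
      (1 + δ) * ‖w.1‖ ^ 2 ≤ ∑ i, ‖w.2 i‖ ^ 2 := by
  intro w hw
  set I := ∫ t in (0 : ℝ)..l, deriv g t ^ 2
  have hI : 0 < I := hg.integral_deriv_sq_pos hl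
  have hblock : ∀ j < N / n, ∃ b : ℝ, 0 < b ∧ b ≤ 2 * n ∧
      (cut n N (j + 1) : ℝ) * l - cut n N j * l = b * l ∧
      κ ^ 2 * (b * (e / 2) ^ 2) * I ≤ ∫ x in (cut n N j : ℝ) * l..cut n N (j + 1) * l,
        (κ * profile l (deriv g) ω x) ^ 2 := by
    intro j hj
    obtain ⟨h1, h2⟩ := cut_succ_bounds hn hj
    have hsum := hω.2 j hj
    rw [integral_profile_sq hl hg.continuous_deriv hg.support_deriv_subset κ ω (by omega)]
    have h1' : (cut n N j : ℝ) + n ≤ cut n N (j + 1) := by exact_mod_cast h1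
    have h2' : (cut n N (j + 1) : ℝ) ≤ cut n N j + 2 * n := by exact_mod_cast h2
    have hn' : (0 : ℝ) < n := by exact_mod_cast hn
    set b : ℝ := (cut n N (j + 1) : ℝ) - cut n N j with hb
    have hb0 : 0 < b := by linarith
    refine ⟨b, hb0, by linarith, by ring, ?_⟩
    have hcs := sq_sum_le_card_mul_sum_sq (s := Finset.Ico (cut n N j) (cut n N (j + 1)))
      (f := fun k : ℕ => (ω k : ℝ))
    rw [Nat.card_Ico, Nat.cast_sub (by omega), ← hb] at hcs
    have h3 : (b * (e / 2)) ^ 2 ≤ (∑ k ∈ Finset.Ico (cut n N j) (cut n N (j + 1)), (ω k : ℝ)) ^ 2 :=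
      pow_le_pow_left₀ (by positivity) hsum 2
    have h4 : b * (b * (e / 2) ^ 2) ≤
        b * ∑ k ∈ Finset.Ico (cut n N j) (cut n N (j + 1)), (ω k : ℝ) ^ 2 := by
      calc b * (b * (e / 2) ^ 2) = (b * (e / 2)) ^ 2 := by ring
        _ ≤ _ := h3.trans hcs
    gcongr
    exact le_of_mul_le_mul_left h4 hb0
  have hcl : (cut n N (N / n) : ℝ) * l = N * l := by rw [cut_last]
  have habs : ∀ {t : ℝ}, |t| ≤ 1 → |κ * t| ≤ κ := fun {t} ht => by
    rw [abs_mul, abs_of_pos hκ0]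
    exact mul_le_of_le_one_right hκ0.le ht
  refine form_bound_of_test (fun φ h1 h2 h3 => form_bound_complex (fun ψ hψ hψc hψs => ?_) h1 h2 h3)
    hw
  have key := form_bound_real (Γ := fun x => κ * profile l g ω x)
    (P := fun x => κ * profile l (deriv g) ω x) (P' := fun x => κ * profile l (deriv (deriv g)) ω x)
    (c := fun j => (cut n N j : ℝ) * l) (m := N / n) hκ0.le hκ
    (fun x => (hasDerivAt_profile hl hg.support_subset hg.support_deriv_subset hg.hasDerivAt ω
      x).const_mul κ)
    (fun x => (hasDerivAt_profile hl hg.support_deriv_subset hg.support_deriv_deriv_subset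
      hg.hasDerivAt_deriv ω x).const_mul κ)
    (continuous_const.mul (continuous_profile hl hg.continuous_deriv_deriv
      hg.support_deriv_deriv_subset ω))
    (fun x => habs (abs_profile_le hl hg.support_deriv_subset hg.abs_deriv_le hω.1 x))
    (fun x => habs (abs_profile_le hl hg.support_deriv_deriv_subset hg.abs_deriv_deriv_le hω.1 x))
    (by rw [cut_zero hn hnN]; simp)
    (fun j hj => by
      have := (cut_succ_bounds hn hj).1
      have h' : (cut n N j : ℝ) ≤ cut n N (j + 1) := by exact_mod_cast (by omega)
      exact mul_le_mul_of_nonneg_right h' hl.le)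
    (fun j => by rw [profile_mul_eq_zero hl hg.support_deriv_subset, mul_zero])
    (by positivity)
    (fun j hj => by
      obtain ⟨b, hb0, -, -, hb⟩ := hblock j hj
      exact lt_of_lt_of_le (by positivity) hb)
    (fun j hj => ?_) hδ0 hδ hψ hψc hψs
  · rw [hcl] at key
    exact key
  · obtain ⟨b, hb0, hbn, hbl, hb⟩ := hblock j hj
    rw [hbl]
    set S := ∫ x in (cut n N j : ℝ) * l..cut n N (j + 1) * l, (κ * profile l (deriv g) ω x) ^ 2
    have hlow : 0 < κ ^ 2 * (b * (e / 2) ^ 2) * I := by positivity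
    have h1 : κ ^ 2 / S ^ 2 ≤ κ ^ 2 / (κ ^ 2 * (b * (e / 2) ^ 2) * I) ^ 2 := by gcongr
    have h2 : (b * l) ^ 2 * (κ ^ 2 / (κ ^ 2 * (b * (e / 2) ^ 2) * I) ^ 2) =
        16 * l ^ 2 / (κ ^ 2 * e ^ 4 * I ^ 2) := by
      field_simp
      norm_num
    have h3 : (b * l) ^ 2 ≤ (2 * n * l) ^ 2 := by gcongr
    have h4 := mul_le_mul_of_nonneg_left h1 (sq_nonneg (b * l))
    rw [h2] at h4
    calc 672 * (b * l) ^ 2 * (κ ^ 2 / S ^ 2 + 1) + 60 =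
          672 * ((b * l) ^ 2 * (κ ^ 2 / S ^ 2) + (b * l) ^ 2) + 60 := by ring
      _ ≤ _ := by gcongr

/-! ### The probability of good configurations -/

section Probability

open ProbabilityTheory

variable {μ : Measure ℝ≥0} [IsProbabilityMeasure μ]

instance : IsProbabilityMeasure (law μ) := by unfold law; infer_instance

theorem ae_le_one (hμ1 : μ (Iic 1) = 1) : ∀ᵐ t ∂μ, t ≤ 1 :=
  (prob_compl_eq_zero_iff measurableSet_Iic).2 hμ1

theorem measurePreserving_eval_law (k : ℤ) : MeasurePreserving (fun ω : ℤ → ℝ≥0 => ω k) (law μ) μ :=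
  measurePreserving_eval_infinitePi (fun _ : ℤ => μ) k

theorem mean_pos (hμ1 : μ (Iic 1) = 1) (hμ0 : μ ≠ Measure.dirac 0) : 0 < mean μ := by
  have hint : Integrable (fun t : ℝ≥0 => (t : ℝ)) μ :=
    Integrable.of_mem_Icc 0 1 (by fun_prop) (by
      filter_upwards [ae_le_one hμ1] with t ht
      exact ⟨t.2, by exact_mod_cast ht⟩)
  refine lt_of_le_of_ne (integral_nonneg fun t => t.2) fun h => hμ0 ?_
  have h1 := (integral_eq_zero_iff_of_nonneg (fun t : ℝ≥0 => t.2) hint).1 h.symm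
  have h2 : (id : ℝ≥0 → ℝ≥0) =ᵐ[μ] fun _ => 0 := by
    filter_upwards [h1] with t ht
    exact NNReal.coe_eq_zero.1 ht
  have h3 : μ.map id = μ.map fun _ => 0 := Measure.map_congr h2
  rwa [Measure.map_id, Measure.map_const, measure_univ, one_smul] at h3

/-- Hoeffding's inequality for the event that the mean of a family of shifts falls below half of its
expectation. -/
theorem law_sum_lt_le (hμ1 : μ (Iic 1) = 1) (hμ0 : μ ≠ Measure.dirac 0) (s : Finset ℕ)
    (hs : s.Nonempty) :
    (law μ).real {ω | ∑ k ∈ s, (ω k : ℝ) < s.card * (mean μ / 2)} ≤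
      Real.exp (-(mean μ ^ 2 / 2) * s.card) := by
  have he := mean_pos hμ1 hμ0
  have hcard : (0 : ℝ) < s.card := by exact_mod_cast hs.card_pos
  set X : ℕ → (ℤ → ℝ≥0) → ℝ := fun k ω => -(ω k : ℝ) - (law μ)[fun ω => -(ω k : ℝ)] with hX
  have hmean : ∀ k : ℕ, (law μ)[fun ω => -(ω k : ℝ)] = -mean μ := fun k => by
    have h1 := integral_map (μ := law μ) (φ := fun ω : ℤ → ℝ≥0 => ω k) (f := fun t => (t : ℝ))
      (measurable_pi_apply _).aemeasurable (Measurable.aestronglyMeasurable (by fun_prop))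
    rw [(measurePreserving_eval_law (μ := μ) k).map_eq] at h1
    rw [integral_neg, mean, h1]
  have hindep : iIndepFun X (law μ) := by
    have h1 : iIndepFun (fun (k : ℤ) (ω : ℤ → ℝ≥0) => -(ω k : ℝ) - -mean μ) (law μ) :=
      iIndepFun_infinitePi (P := fun _ : ℤ => μ) (X := fun _ (t : ℝ≥0) => -(t : ℝ) - -mean μ)
        fun _ => by fun_prop
    have h2 := h1.precomp (g := fun k : ℕ => (k : ℤ)) Nat.cast_injective
    simpa only [hX, hmean] using h2
  have hsub : ∀ k ∈ s, HasSubgaussianMGF (X k) ((‖(0 : ℝ) - (-1)‖₊ / 2) ^ 2) (law μ) := fun k _ => by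
    refine hasSubgaussianMGF_of_mem_Icc (Measurable.aemeasurable (by fun_prop)) ?_
    filter_upwards [(measurePreserving_eval_law (μ := μ) k).quasiMeasurePreserving.ae
      (ae_le_one hμ1)] with ω hω
    have : (ω k : ℝ) ≤ 1 := by exact_mod_cast hω
    exact ⟨by linarith, by simp⟩
  have hH := HasSubgaussianMGF.measure_sum_ge_le_of_iIndepFun hindep hsub
    (ε := s.card * (mean μ / 2)) (by positivity)
  refine (measureReal_mono fun ω hω => ?_).trans (hH.trans (le_of_eq ?_))
  · simp only [mem_ofPred_eq] at hω ⊢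
    simp only [hX, hmean, Finset.sum_sub_distrib, Finset.sum_neg_distrib, Finset.sum_const,
      nsmul_eq_mul]
    linarith
  · congr 1
    simp only [Finset.sum_const, nsmul_eq_mul]
    have : ((‖(0 : ℝ) - (-1)‖₊ / 2) ^ 2 : ℝ≥0) = (1 / 4 : ℝ) := by
      push_cast
      norm_num
    push_cast at this ⊢
    rw [this]
    field_simp
    ring

theorem measurableSet_goodSet (e : ℝ) (n N : ℕ) : MeasurableSet (goodSet e n N) := by
  have h1 : MeasurableSet {ω : ℤ → ℝ≥0 | ∀ k, ω k ≤ 1} := by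
    have : {ω : ℤ → ℝ≥0 | ∀ k, ω k ≤ 1} = ⋂ k, {ω | ω k ≤ 1} := by ext; simp
    rw [this]
    exact MeasurableSet.iInter fun k => measurableSet_le (by fun_prop) (by fun_prop)
  have h2 : MeasurableSet {ω : ℤ → ℝ≥0 | ∀ j < N / n,
      ((cut n N (j + 1) : ℝ) - cut n N j) * (e / 2) ≤
        ∑ k ∈ Finset.Ico (cut n N j) (cut n N (j + 1)), (ω k : ℝ)} := by
    have : {ω : ℤ → ℝ≥0 | ∀ j < N / n, ((cut n N (j + 1) : ℝ) - cut n N j) * (e / 2) ≤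
        ∑ k ∈ Finset.Ico (cut n N j) (cut n N (j + 1)), (ω k : ℝ)} =
      ⋂ j, ⋂ _ : j < N / n, {ω | ((cut n N (j + 1) : ℝ) - cut n N j) * (e / 2) ≤
        ∑ k ∈ Finset.Ico (cut n N j) (cut n N (j + 1)), (ω k : ℝ)} := by ext; simp
    rw [this]
    exact MeasurableSet.iInter fun j => MeasurableSet.iInter fun _ =>
      measurableSet_le (by fun_prop) (by fun_prop)
  exact h1.inter h2

theorem law_goodSet_compl_le (hμ1 : μ (Iic 1) = 1) (hμ0 : μ ≠ Measure.dirac 0) {γ : ℝ} {n N : ℕ}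
    (hn : 0 < n) (hN : 0 < N) (hγn : (N : ℝ) ^ (1 / γ) ≤ n) :
    (law μ).real (goodSet (mean μ) n N)ᶜ ≤ tail (mean μ ^ 2 / 2) γ N := by
  have hN' : (0 : ℝ) < N := by exact_mod_cast hN
  set c := mean μ ^ 2 / 2
  have hc : 0 ≤ c := by positivity
  set block : ℕ → Finset ℕ := fun j => Finset.Ico (cut n N j) (cut n N (j + 1))
  set bad : ℕ → Set (ℤ → ℝ≥0) :=
    fun j => {ω | ∑ k ∈ block j, (ω k : ℝ) < (block j).card * (mean μ / 2)}
  have hcard : ∀ j < N / n, n ≤ (block j).card ∧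
      ((block j).card : ℝ) = (cut n N (j + 1) : ℝ) - cut n N j := fun j hj => by
    have := (cut_succ_bounds hn hj).1
    simp only [block, Nat.card_Ico]
    exact ⟨by omega, by rw [Nat.cast_sub (by omega)]⟩
  have hsub : (goodSet (mean μ) n N)ᶜ ⊆
      {ω | ¬ ∀ k, ω k ≤ 1} ∪ ⋃ j ∈ Finset.range (N / n), bad j := by
    intro ω hω
    by_cases h : ∀ k, ω k ≤ 1
    · right
      have h2 : ¬ ∀ j < N / n, _ := fun h2 => hω ⟨h, h2⟩
      push Not at h2
      obtain ⟨j, hj, h3⟩ := h2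
      rw [← (hcard j hj).2] at h3
      exact mem_biUnion (Finset.mem_coe.2 (Finset.mem_range.2 hj)) h3
    · exact Or.inl h
  have hzero : (law μ).real {ω | ¬ ∀ k, ω k ≤ 1} = 0 := by
    rw [measureReal_def, ENNReal.toReal_eq_zero_iff]
    left
    have : ∀ᵐ ω ∂law μ, ∀ k, ω k ≤ 1 := ae_all_iff.2 fun k =>
      (measurePreserving_eval_law (μ := μ) k).quasiMeasurePreserving.ae (ae_le_one hμ1)
    exact this
  have hbad : ∀ j ∈ Finset.range (N / n),
      (law μ).real (bad j) ≤ Real.exp (-c * (N : ℝ) ^ (1 / γ)) := fun j hj => by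
    have h1 := (hcard j (Finset.mem_range.1 hj)).1
    refine (law_sum_lt_le hμ1 hμ0 (block j) (Finset.card_pos.1 (by omega))).trans ?_
    refine Real.exp_le_exp.2 ?_
    have h2 : (n : ℝ) ≤ (block j).card := by exact_mod_cast h1
    rw [neg_mul, neg_mul]
    exact neg_le_neg (mul_le_mul_of_nonneg_left (hγn.trans h2) hc)
  have hblocks : ((N / n : ℕ) : ℝ) ≤ (N : ℝ) ^ (1 - 1 / γ) := by
    refine Nat.cast_div_le.trans ?_
    rw [Real.rpow_sub hN', Real.rpow_one]
    gcongr
  calc (law μ).real (goodSet (mean μ) n N)ᶜ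
      ≤ (law μ).real {ω | ¬ ∀ k, ω k ≤ 1} +
          (law μ).real (⋃ j ∈ Finset.range (N / n), bad j) :=
        (measureReal_mono hsub).trans (measureReal_union_le _ _)
    _ ≤ 0 + ∑ j ∈ Finset.range (N / n), (law μ).real (bad j) := by
        rw [hzero]
        gcongr
        exact measureReal_biUnion_finset_le _ _
    _ ≤ 0 + ∑ j ∈ Finset.range (N / n), Real.exp (-c * (N : ℝ) ^ (1 / γ)) := by
        gcongr with j hj
        exact hbad j hj
    _ = ((N / n : ℕ) : ℝ) * Real.exp (-c * (N : ℝ) ^ (1 / γ)) := by simp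
    _ ≤ tail c γ N := mul_le_mul_of_nonneg_right hblocks (Real.exp_pos _).le

end Probability

/-! ### Large `N` -/

theorem eventually_const_mul_rpow_le (C : ℝ) {s η : ℝ} (hs : 0 < s) (hη : 0 < η) :
    ∀ᶠ N : ℕ in Filter.atTop, C * (N : ℝ) ^ (-s) ≤ η := by
  have h1 := ((tendsto_rpow_neg_atTop hs).comp tendsto_natCast_atTop_atTop).const_mul C
  rw [mul_zero] at h1
  exact h1.eventually (ge_mem_nhds hη)

/-- For large `N` the coupling interval is non-empty and contained in `(0, 1]`, and the block length
`⌈N^{1/γ}⌉` meets the hypothesis of `form_bound_guide` with `δ = 2 / √N`. -/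
theorem eventually_coupling {e c₂ c₃ l I γ : ℝ} (he : 0 < e) (hc₂ : 0 < c₂) (hc₃ : 0 < c₃)
    (hl : 0 < l) (hI : 0 < I) (hγ : 34 < γ) :
    ∀ᶠ N : ℕ in Filter.atTop,
      1 ≤ N ∧ ⌈(N : ℝ) ^ (1 / γ)⌉₊ ≤ N ∧ 0 < ⌈(N : ℝ) ^ (1 / γ)⌉₊ ∧
      2 * (N : ℝ) ^ (1 / γ - 1 / 4) / (e * √c₂) ≤ c₃ * (N : ℝ) ^ (-(15 / (2 * γ))) ∧
      ∀ κ ∈ Icc (2 * (N : ℝ) ^ (1 / γ - 1 / 4) / (e * √c₂)) (c₃ * (N : ℝ) ^ (-(15 / (2 * γ)))),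
        0 < κ ∧ κ ≤ 1 ∧ 2 / √(N : ℝ) * (672 * (16 * l ^ 2 / (κ ^ 2 * e ^ 4 * I ^ 2) +
          (2 * ⌈(N : ℝ) ^ (1 / γ)⌉₊ * l) ^ 2) + 60) ≤ 1 := by
  have hγ0 : 0 < γ := by linarith
  have hγ1 : 1 / γ < 1 / 34 := one_div_lt_one_div_of_lt (by norm_num) hγ
  have hγ2 : 0 < 1 / γ := by positivity
  have hγ3 : 15 / (2 * γ) = 15 / 2 * (1 / γ) := by field_simp
  filter_upwards [Filter.eventually_ge_atTop 1,
    eventually_const_mul_rpow_le (2 / (e * √c₂)) (s := 1 / 4 - 17 / 2 * (1 / γ)) (by linarith) hc₃,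
    eventually_const_mul_rpow_le c₃ (s := 15 / 2 * (1 / γ)) (by linarith) one_pos,
    eventually_const_mul_rpow_le (2 * (672 * (16 * l ^ 2 * c₂ / (4 * e ^ 2 * I ^ 2))))
      (s := 2 * (1 / γ)) (by linarith) (η := 1 / 3) (by norm_num),
    eventually_const_mul_rpow_le (2 * (672 * (16 * l ^ 2))) (s := 1 / 2 - 2 * (1 / γ)) (by linarith)
      (η := 1 / 3) (by norm_num),
    eventually_const_mul_rpow_le (2 * 60) (s := 1 / 2) (by norm_num) (η := 1 / 3) (by norm_num)]
    with N hN h1 h2 h3 h4 h5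
  have hN1 : (1 : ℝ) ≤ N := by exact_mod_cast hN
  have hN0 : (0 : ℝ) < N := by linarith
  set τ := 1 / γ
  have hroot : 1 ≤ (N : ℝ) ^ τ := Real.one_le_rpow hN1 hγ2.le
  have hsqrt : 2 / √(N : ℝ) = 2 * (N : ℝ) ^ (-(1 / 2) : ℝ) := by
    rw [Real.sqrt_eq_rpow, Real.rpow_neg hN0.le, div_eq_mul_inv]
  rw [hγ3]
  refine ⟨hN, ?_, ?_, ?_, fun κ hκ => ?_⟩
  · rw [Nat.ceil_le]
    calc (N : ℝ) ^ τ ≤ (N : ℝ) ^ (1 : ℝ) := Real.rpow_le_rpow_of_exponent_le hN1 (by linarith)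
      _ = N := Real.rpow_one _
  · exact Nat.ceil_pos.2 (by linarith)
  · calc 2 * (N : ℝ) ^ (τ - 1 / 4) / (e * √c₂) =
          2 / (e * √c₂) * (N : ℝ) ^ (-(1 / 4 - 17 / 2 * τ)) * (N : ℝ) ^ (-(15 / 2 * τ)) := by
          rw [mul_assoc, ← Real.rpow_add hN0,
            show -(1 / 4 - 17 / 2 * τ) + -(15 / 2 * τ) = τ - 1 / 4 by ring]
          ring
      _ ≤ c₃ * (N : ℝ) ^ (-(15 / 2 * τ)) := by gcongr
  · have hlow : 0 < 2 * (N : ℝ) ^ (τ - 1 / 4) / (e * √c₂) := by positivity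
    have hκ0 : 0 < κ := hlow.trans_le hκ.1
    refine ⟨hκ0, hκ.2.trans h2, ?_⟩
    have hκsq : 4 * (N : ℝ) ^ (2 * τ - 1 / 2) / (e ^ 2 * c₂) ≤ κ ^ 2 := by
      calc 4 * (N : ℝ) ^ (2 * τ - 1 / 2) / (e ^ 2 * c₂) =
            (2 * (N : ℝ) ^ (τ - 1 / 4) / (e * √c₂)) ^ 2 := by
            rw [div_pow, mul_pow, mul_pow, Real.sq_sqrt hc₂.le,
              ← Real.rpow_natCast ((N : ℝ) ^ (τ - 1 / 4)) 2, ← Real.rpow_mul hN0.le,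
              show (τ - 1 / 4) * ((2 : ℕ) : ℝ) = 2 * τ - 1 / 2 by push_cast; ring]
            norm_num
        _ ≤ κ ^ 2 := pow_le_pow_left₀ hlow.le hκ.1 2
    have t1 : 2 / √(N : ℝ) * (672 * (16 * l ^ 2 / (κ ^ 2 * e ^ 4 * I ^ 2))) ≤ 1 / 3 := by
      refine le_trans ?_ h3
      calc 2 / √(N : ℝ) * (672 * (16 * l ^ 2 / (κ ^ 2 * e ^ 4 * I ^ 2)))
          ≤ 2 / √(N : ℝ) * (672 * (16 * l ^ 2 /
              (4 * (N : ℝ) ^ (2 * τ - 1 / 2) / (e ^ 2 * c₂) * e ^ 4 * I ^ 2))) := by gcongr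
        _ = 2 * (672 * (16 * l ^ 2 * c₂ / (4 * e ^ 2 * I ^ 2))) *
              ((N : ℝ) ^ (-(1 / 2) : ℝ) / (N : ℝ) ^ (2 * τ - 1 / 2)) := by
            rw [hsqrt]
            have := Real.rpow_pos_of_pos hN0 (2 * τ - 1 / 2)
            field_simp
        _ = _ := by
            rw [← Real.rpow_sub hN0, show -(1 / 2) - (2 * τ - 1 / 2) = -(2 * τ) by ring]
    have t2 : 2 / √(N : ℝ) * (672 * (2 * ⌈(N : ℝ) ^ τ⌉₊ * l) ^ 2) ≤ 1 / 3 := by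
      refine le_trans ?_ h4
      have hceil : (⌈(N : ℝ) ^ τ⌉₊ : ℝ) ≤ 2 * (N : ℝ) ^ τ := by
        have := (Nat.ceil_lt_add_one (by positivity : 0 ≤ (N : ℝ) ^ τ)).le
        linarith
      calc 2 / √(N : ℝ) * (672 * (2 * ⌈(N : ℝ) ^ τ⌉₊ * l) ^ 2)
          ≤ 2 / √(N : ℝ) * (672 * (2 * (2 * (N : ℝ) ^ τ) * l) ^ 2) := by gcongr
        _ = 2 * (672 * (16 * l ^ 2)) * ((N : ℝ) ^ (-(1 / 2) : ℝ) * ((N : ℝ) ^ τ) ^ 2) := by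
            rw [hsqrt]; ring
        _ = _ := by
            rw [← Real.rpow_natCast ((N : ℝ) ^ τ) 2, ← Real.rpow_mul hN0.le, ← Real.rpow_add hN0]
            congr 2
            push_cast; ring
    have t3 : 2 / √(N : ℝ) * 60 ≤ 1 / 3 := by
      refine le_trans (le_of_eq ?_) h5
      rw [hsqrt]; ring
    linarith

/-! ### The initial length scale estimate -/

/-- The pieces at the two ends contain points at the common height `π / 2`, so their distance is at
most their separation along the axis. -/
theorem setDist_guidePiece_le {l κ α β L : ℝ} {g : ℝ → ℝ} {ω : ℤ → ℝ≥0} (hl : 0 < l)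
    (hg : IsBump l g) (hκ : κ ∈ Icc (0 : ℝ) 1) (hω : ∀ k, ω k ≤ 1) (hα : 0 ≤ α) (hαL : α ≤ L)
    (hβ : 0 ≤ β) :
    setDist (guidePiece l g κ ω 0 α) (guidePiece l g κ ω (L - β) L) ≤ max 0 (L - β - α) := by
  have hbdd : BddBelow {d | ∃ a ∈ guidePiece l g κ ω 0 α, ∃ b ∈ guidePiece l g κ ω (L - β) L,
      d = dist a b} := ⟨0, by rintro _ ⟨a, -, b, -, rfl⟩; exact dist_nonneg⟩
  have hmem : ∀ {a b x : ℝ}, a ≤ x → x ≤ b → point x (Real.pi / 2) ∈ guidePiece l g κ ω a b := by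
    intro a b x hax hxb
    have h1 := abs_le.1 (abs_profile_le hl hg.support_subset hg.abs_le hω x)
    have hpi := Real.pi_gt_three
    refine ⟨by simpa using ⟨hax, hxb⟩, ?_, ?_⟩
    · simp only [point_zero, point_one]
      nlinarith [hκ.1, hκ.2, h1.1, h1.2]
    · simp only [point_zero, point_one]
      nlinarith [hκ.1, hκ.2, h1.1, h1.2]
  rcases le_total α (L - β) with h | h
  · refine (csInf_le hbdd ⟨_, hmem hα le_rfl, _, hmem le_rfl (by linarith : L - β ≤ L), rfl⟩).trans ?_
    rw [EuclideanSpace.dist_eq, Fin.sum_univ_two]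
    simp only [point_zero, point_one, dist_self, Real.dist_eq]
    rw [sq_abs, zero_pow two_ne_zero, add_zero, Real.sqrt_sq_eq_abs, abs_sub_comm,
      abs_of_nonneg (by linarith)]
    exact le_max_right _ _
  · refine (csInf_le hbdd ⟨_, hmem hα le_rfl, _, hmem h hαL, rfl⟩).trans ?_
    rw [dist_self]
    exact le_max_left _ _

/-- The resolvent estimate for a single configuration that satisfies the form bound. -/
theorem exists_resolvent_decay {l κ α β E : ℝ} {g : ℝ → ℝ} {ω : ℤ → ℝ≥0} {N : ℕ} (hl : 0 < l)
    (hg : IsBump l g) (hκ : κ ∈ Icc (0 : ℝ) 1) (hω : ∀ k, ω k ≤ 1) (hN : 1 ≤ N)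
    (hδ : ∀ w ∈ formDomainGraph (guideSegment l g κ ω N) (guide l g κ ω),
      (1 + 2 / √(N : ℝ)) * ‖w.1‖ ^ 2 ≤ ∑ i, ‖w.2 i‖ ^ 2)
    (hα : 0 ≤ α) (hαL : α ≤ N * l) (hβ : 0 ≤ β)
    (hE : E ∈ Icc (1 : ℝ) (1 + 1 / (2 * √(N : ℝ)))) :
    ∃ R : L2 (guideSegment l g κ ω N) →L[ℂ] L2 (guideSegment l g κ ω N),
      IsResolvent (hamiltonian l g κ ω N) (E : ℂ) R ∧
        ‖chi (guideSegment l g κ ω N) (guidePiece l g κ ω 0 α) ∘L R ∘L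
          chi (guideSegment l g κ ω N) (guidePiece l g κ ω (N * l - β) (N * l))‖ ≤
            2 * √(N : ℝ) * Real.exp (-(setDist (guidePiece l g κ ω 0 α)
              (guidePiece l g κ ω (N * l - β) (N * l)) / (48 * √(N : ℝ)))) := by
  have hN1 : (1 : ℝ) ≤ √(N : ℝ) := Real.one_le_sqrt.2 (by exact_mod_cast hN)
  set r := √(N : ℝ)
  have hr : 0 < r := by linarith
  have hopen := isOpen_guideSegment hl hg.continuous hg.support_subset κ ω N
  have hEr : E ≤ 1 + 1 / (2 * r) := hE.2
  have hhalf : 1 / (2 * r) = 1 / 2 * r⁻¹ := by field_simp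
  have hr1 : r⁻¹ ≤ 1 := inv_le_one_of_one_le₀ hN1
  have hr0 : 0 < r⁻¹ := inv_pos.2 hr
  obtain ⟨R, hR, hR'⟩ := exists_isResolvent hopen inter_subset_right hδ (E := E)
    (by linarith [hE.1]) (by rw [hhalf] at hEr; rw [div_eq_mul_inv]; linarith)
  refine ⟨R, hR, ?_⟩
  -- the decay rate `a` is set to zero when the two pieces overlap
  have main : ∀ a : ℝ, 0 ≤ a → a ≤ 1 / (48 * r) →
      ‖chi (guideSegment l g κ ω N) (guidePiece l g κ ω 0 α) ∘L R ∘L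
        chi (guideSegment l g κ ω N) (guidePiece l g κ ω (N * l - β) (N * l))‖ ≤
          2 * r * Real.exp (-(a * (N * l - β - α))) := by
    intro a ha0 ha
    have hrate : 1 / (48 * r) = 1 / 48 * r⁻¹ := by field_simp
    have ha2 : a ^ 2 ≤ 1 / 2 * r⁻¹ := by
      rw [hrate] at ha
      nlinarith
    have hgap : 1 / 2 * r⁻¹ ≤ 2 / r + 1 - E - a ^ 2 := by
      rw [hhalf] at hEr
      rw [div_eq_mul_inv 2 r]
      linarith
    have hgap0 : 0 < 1 / 2 * r⁻¹ := by positivity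
    refine (norm_chi_resolvent_chi_le (s := N * l - β) (t := a * (N * l - β - α)) hopen.measurableSet
      (fun x hx => hx.1.1) ha0 hδ (hgap0.trans_le hgap)
      (measurableSet_guidePiece hl hg.continuous hg.support_subset κ ω _ _)
      (measurableSet_guidePiece hl hg.continuous hg.support_subset κ ω _ _)
      (fun x hx => mul_le_mul_of_nonneg_left (by linarith [hx.1.2]) ha0)
      (fun x hx => hx.1.1) hR').trans ?_
    refine mul_le_mul_of_nonneg_right ?_ (Real.exp_pos _).le
    calc (2 / r + 1 - E - a ^ 2)⁻¹ ≤ (1 / 2 * r⁻¹)⁻¹ := inv_anti₀ hgap0 hgap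
      _ = 2 * r := by field_simp
  have hdist := setDist_guidePiece_le hl hg hκ hω hα hαL hβ
  have hd48 : 0 < 48 * r := by positivity
  rcases le_total 0 (N * l - β - α) with h | h
  · rw [max_eq_right h] at hdist
    refine (main (1 / (48 * r)) (by positivity) le_rfl).trans ?_
    gcongr
    rw [div_mul_eq_mul_div, one_mul]
    gcongr
  · rw [max_eq_left h] at hdist
    refine (main 0 le_rfl (by positivity)).trans ?_
    gcongr
    rw [zero_mul]
    exact div_nonpos_of_nonpos_of_nonneg hdist hd48.le

end Waveguide

end

theorem corollary3p3 (μ : Measure ℝ≥0) [IsProbabilityMeasure μ] (hμ1 : μ (Iic 1) = 1)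
    (hμ0 : μ ≠ Measure.dirac 0) :
    ∃ c₄ : ℝ, 0 < c₄ ∧ ∀ (l : ℝ) (g : ℝ → ℝ) (γ : ℝ), 1 ≤ l → Waveguide.IsBump l g → 34 < γ →
      ∃ N₁ : ℕ, ∀ N : ℕ, N₁ ≤ N →
        (Waveguide.couplingInterval μ l g γ N).Nonempty ∧
        (∀ κ ∈ Waveguide.couplingInterval μ l g γ N,
          Waveguide.law μ {ω | ∃ E : ℝ, Waveguide.IsEigenvalue (Waveguide.hamiltonian l g κ ω N) E ∧
            E - 1 ≤ (N : ℝ) ^ (-(1 / 2) : ℝ)} ≤ ENNReal.ofReal (Waveguide.tail c₄ γ N)) ∧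
        ∀ κ ∈ Waveguide.couplingInterval μ l g γ N ∩ Icc 0 1, ∀ α β : ℝ,
          2 ≤ α → α ≤ N * l → 2 ≤ β → β ≤ N * l →
          ∃ S : Set (ℤ → ℝ≥0), MeasurableSet S ∧
            1 - Waveguide.tail c₄ γ N ≤ (Waveguide.law μ).real S ∧
            ∀ ω ∈ S, ∀ E ∈ Icc (1 : ℝ) (1 + 1 / (2 * √(N : ℝ))),
              ∃ R : Waveguide.L2 (Waveguide.guideSegment l g κ ω N) →L[ℂ]
                  Waveguide.L2 (Waveguide.guideSegment l g κ ω N),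
                Waveguide.IsResolvent (Waveguide.hamiltonian l g κ ω N) (E : ℂ) R ∧
                ‖Waveguide.chi (Waveguide.guideSegment l g κ ω N)
                      (Waveguide.guidePiece l g κ ω 0 α) ∘L R ∘L
                    Waveguide.chi (Waveguide.guideSegment l g κ ω N)
                      (Waveguide.guidePiece l g κ ω (N * l - β) (N * l))‖ ≤
                  2 * √(N : ℝ) *
                    Real.exp (-(Waveguide.setDist (Waveguide.guidePiece l g κ ω 0 α)
                      (Waveguide.guidePiece l g κ ω (N * l - β) (N * l)) / (48 * √(N : ℝ)))) := by
  have he := Waveguide.mean_pos hμ1 hμ0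
  refine ⟨Waveguide.mean μ ^ 2 / 2, by positivity, fun l g γ hl1 hg hγ => ?_⟩
  have hl : 0 < l := by linarith
  have hgt := hg.gTildeNormSq_pos hl
  have hc₂ : 0 < Waveguide.c₂ l g := by unfold Waveguide.c₂; positivity
  have hc₃ : 0 < Waveguide.c₃ l g := by unfold Waveguide.c₃; positivity
  obtain ⟨N₁, hN₁⟩ := Filter.eventually_atTop.1 (Waveguide.eventually_coupling he hc₂ hc₃ hl
    (hg.integral_deriv_sq_pos hl) hγ)
  refine ⟨N₁, fun N hN => ?_⟩
  obtain ⟨hN1, hnN, hn, hne, hκall⟩ := hN₁ N hN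
  set n := ⌈(N : ℝ) ^ (1 / γ)⌉₊
  have hprob := Waveguide.law_goodSet_compl_le hμ1 hμ0 hn hN1 (Nat.le_ceil ((N : ℝ) ^ (1 / γ)))
  have hmeas := Waveguide.measurableSet_goodSet (Waveguide.mean μ) n N
  have hform : ∀ κ ∈ Waveguide.couplingInterval μ l g γ N,
      ∀ ω ∈ Waveguide.goodSet (Waveguide.mean μ) n N, _ := fun κ hκ ω hω =>
    Waveguide.form_bound_guide hl hg he (hκall κ hκ).1 (hκall κ hκ).2.1 hn hnN hω (by positivity)
      (hκall κ hκ).2.2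
  refine ⟨nonempty_Icc.2 hne, fun κ hκ => ?_, fun κ hκ α β hα hαL hβ _ =>
    ⟨Waveguide.goodSet (Waveguide.mean μ) n N, hmeas, ?_, fun ω hω E hE =>
      Waveguide.exists_resolvent_decay hl hg hκ.2 hω.1 hN1 (hform κ hκ.1 ω hω)
        (by linarith) hαL (by linarith) hE⟩⟩
  · rw [measureReal_def] at hprob
    refine le_trans (measure_mono (t := (Waveguide.goodSet (Waveguide.mean μ) n N)ᶜ)
      fun ω hω hgood => ?_)
      (ENNReal.le_ofReal_iff_toReal_le (measure_ne_top _ _)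
        (le_trans ENNReal.toReal_nonneg hprob) |>.2 hprob)
    -- an eigenvalue this close to the bottom contradicts the form bound
    obtain ⟨E, ⟨u, hu0, hu⟩, hE⟩ := hω
    have hN0 : (0 : ℝ) < N := by exact_mod_cast hN1
    rw [Real.rpow_neg hN0.le, ← Real.sqrt_eq_rpow] at hE
    have hs : 0 < (√(N : ℝ))⁻¹ := inv_pos.2 (Real.sqrt_pos.2 hN0)
    refine hu0 (Waveguide.eq_zero_of_mem_laplacianGraph (hform κ hκ ω hgood) (E := E)
      (by rw [div_eq_mul_inv]; linarith) ?_)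
    rw [← hu, ← Waveguide.mixedLaplacian_graph (Waveguide.isOpen_guideSegment hl hg.continuous
      hg.support_subset κ ω N) inter_subset_right]
    exact LinearPMap.mem_graph _ u
  · rw [measureReal_compl hmeas, probReal_univ] at hprob
    linarith
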